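/- Let $\mathcal F^2$ be the Fock space of entire functions $F:\mathbb C\to\mathbb C$ with $\|F\|^2=\int_{\mathbb C}|F(z)|^2e^{-\pi|z|^2}\,dA(z)<\infty$, where $dA$ is Lebesgue measure. For a real-valued measurable $\sigma$ on $\mathbb C$, the Toeplitz operator $T_\sigma$ on $\mathcal F^2$ is the bounded operator, when it exists, such that $$\langle T_\sigma F,H\rangle=\int_{\mathbb C}\sigma(z)F(z)\overline{H(z)}e^{-\pi|z|^2}\,dA(z)\qquad\text{for all }F,H\in\mathcal F^2,$$ the integrals being absolutely convergent. Let $\lambda_1(\sigma)\ge\lambda_2(\sigma)\ge\cdots\ge 0$ denote the eigenvalues of $T_\sigma$ in decreasing order, repeated according to multiplicity (for nonnegative $\sigma\in L^p(\mathbb C)$, $1\le p<\infty$, $T_\sigma$ is compact, self-adjoint and nonnegative). For $n\ge 1$ put $$G_n(s)=n-\sum_{k=0}^{n-1}(n-k)\frac{s^k}{k!}e^{-s}.$$ **Theorem.** Let $1<p<\infty$, $B>0$ and $n\ge 1$. Let $c_p$ be defined by $c_p^p=\int_0^\infty (G_n'(s))^{p/(p-1)}\,ds$; this integral is finite and $c_p>0$.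 Let $$\sigma_p(z)=\frac{B}{c_p}\left(\sum_{k=0}^{n-1}\frac{(\pi|z|^2)^k}{k!}\right)^{\frac1{p-1}}e^{-\frac{\pi|z|^2}{p-1}},\qquad z\in\mathbb C.$$ Then $\sigma_p\in L^p(\mathbb C)$, $\|\sigma_p\|_p\le B$, and $T_{\sigma_p}$ is well defined. Moreover, for every radial nonnegative $\sigma\in L^p(\mathbb C)$ with $\|\sigma\|_p\le B$ (radial: $\sigma(z)$ depends only on $|z|$, up to a null set), $T_\sigma$ is well defined and $$\sum_{k=1}^n\lambda_k(\sigma)\le\sum_{k=1}^n\lambda_k(\sigma_p),$$ with equality if and only if $\sigma(z)=\sigma_p(z)$ for a.e. $z\in\mathbb C$. -/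

import Mathlib

noncomputable section

namespace FockToeplitz

open MeasureTheory

/-- The Gaussian measure `e^{-π|z|²} dA(z)` on `ℂ`, with `dA` the Lebesgue measure. -/
def fockMeasure : Measure ℂ :=
  volume.withDensity fun z => ENNReal.ofReal (Real.exp (-Real.pi * ‖z‖ ^ 2))

/-- The Fock space: the subspace of `L²(ℂ, e^{-π|z|²} dA)` formed by the (classes of) entire
functions, with the inherited inner product. An entire function is determined by its class. -/
def fockSpace : Submodule ℂ (Lp ℂ 2 fockMeasure) where
  carrier := {f | ∃ F : ℂ → ℂ, Differentiable ℂ F ∧ f =ᵐ[fockMeasure] F}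
  add_mem' := by
    rintro f g ⟨F, hF, hf⟩ ⟨G, hG, hg⟩
    exact ⟨F + G, hF.add hG, (Lp.coeFn_add f g).trans (hf.add hg)⟩
  zero_mem' := ⟨0, differentiable_const 0, Lp.coeFn_zero _ _ _⟩
  smul_mem' := by
    rintro c f ⟨F, hF, hf⟩
    exact ⟨c • F, hF.const_smul c, (Lp.coeFn_smul c f).trans (hf.const_smul c)⟩

/-- `T` is the Toeplitz operator `F ↦ P(σF)` on the Fock space with (real) symbol `σ`, where `P` is
the orthogonal projection of `L²(ℂ, e^{-π|z|²} dA)` onto the Fock space. Since `σF` need not be in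
`L²` for an unbounded `σ`, this is read weakly:
`⟨TF, G⟩ = ∫ σ F conj(G) e^{-π|z|²} dA` for all `F`, `G` in the Fock space, the integrals being
absolutely convergent. There is at most one such `T`. (Mathlib's `inner` is conjugate-linear in
its first argument.) -/
def IsToeplitz (σ : ℂ → ℝ) (T : fockSpace →L[ℂ] fockSpace) : Prop :=
  ∀ F G : fockSpace,
    Integrable (fun z => (σ z : ℂ) * inner ℂ ((G : Lp ℂ 2 fockMeasure) z)
      ((F : Lp ℂ 2 fockMeasure) z)) fockMeasure ∧
    inner ℂ G (T F) = ∫ z, (σ z : ℂ) * inner ℂ ((G : Lp ℂ 2 fockMeasure) z)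
      ((F : Lp ℂ 2 fockMeasure) z) ∂fockMeasure

open Classical in
/-- The Toeplitz operator `T_σ` (by convention `0` if `σ` does not define a bounded operator). -/
def toeplitz (σ : ℂ → ℝ) : fockSpace →L[ℂ] fockSpace :=
  if h : ∃ T, IsToeplitz σ T then h.choose else 0

/-- The `n`-th largest eigenvalue, `n = 1, 2, …`, counted with multiplicity, of a compact
self-adjoint nonnegative operator `T`: the largest `t > 0` such that the eigenspaces of `T` for the
eigenvalues `≥ t` together have dimension at least `n`, and `0` if there is no such `t`. -/
def nthEigenvalue {H : Type*} [NormedAddCommGroup H] [InnerProductSpace ℂ H]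
    (T : H →L[ℂ] H) (n : ℕ) : ℝ :=
  sSup {t : ℝ | 0 < t ∧ (n : Cardinal) ≤ Module.rank ℂ
    (⨆ (μ : ℝ) (_ : t ≤ μ), Module.End.eigenspace (T : H →ₗ[ℂ] H) (μ : ℂ) : Submodule ℂ H)}

/-- `λ_n(σ)`, `n = 1, 2, …`: the `n`-th largest eigenvalue of `T_σ`. -/
def toeplitzEigenvalue (σ : ℂ → ℝ) (n : ℕ) : ℝ := nthEigenvalue (toeplitz σ) n

/-- `σ` is radial (as an almost everywhere class): `σ(z)` depends only on `|z|`. -/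
def IsRadial (σ : ℂ → ℝ) : Prop := ∃ ρ : ℝ → ℝ, ∀ᵐ z : ℂ, σ z = ρ ‖z‖

/-- `G_n(s) = n - ∑_{k<n} (n-k) (s^k / k!) e^{-s}`. -/
def G (n : ℕ) (s : ℝ) : ℝ :=
  n - ∑ k ∈ Finset.range n, ((n : ℝ) - k) * (s ^ k / k.factorial) * Real.exp (-s)

/-- The constant `c_p ≥ 0` with `c_p ^ p = ∫_0^∞ G_n'(s)^{p/(p-1)} ds`. -/
def cConst (p : ℝ) (n : ℕ) : ℝ :=
  (∫ s in Set.Ioi (0 : ℝ), (deriv (G n) s) ^ (p / (p - 1))) ^ (1 / p)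

/-- The optimal symbol `σ_p`. -/
def optSymbol (p B : ℝ) (n : ℕ) (z : ℂ) : ℝ :=
  B / cConst p n *
    (∑ k ∈ Finset.range n, (Real.pi * ‖z‖ ^ 2) ^ k / k.factorial) ^ (1 / (p - 1)) *
    Real.exp (-(Real.pi * ‖z‖ ^ 2) / (p - 1))

end FockToeplitz

end

noncomputable section

namespace FockToeplitz

open MeasureTheory Set Filter Topology

/-! Write `w_k(s) = s^k e^{-s} / k!` and, for a finite set `K` of indices, `W_K = ∑_{k ∈ K} w_k`.
For radial `σ` the normalized monomials diagonalize `T_σ`, with eigenvalues `∫ σ(z) w_k(π|z|²) dA`.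
These tend to zero, so the sum of the `n` largest eigenvalues is the maximum over `|K| = n` of `∫
σ(z) W_K(π|z|²) dA`. The map `z ↦ π|z|²` carries area to Lebesgue measure on `(0, ∞)`. With `q =
p/(p-1)`, Hölder therefore bounds the sum by `B (∫_0^∞ W_K^q)^{1/q}`, and equality forces `σ` to be
a multiple of `W_K^{q-1}`. Since `G_n' = W_{range n}`, the symbol `σ_p` is exactly that multiple for
`K = range n`.

It remains that `∫ W_K^q` is largest, among `|K| = n`, only for `K = range n`
(`integral_poissonSum_rpow_lt`). Let `j` be the first gap of `K ≠ range n`, let `R = range j`, and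
let `K'` arise by lowering every index beyond `j` by one. From `w_k' = w_{k-1} - w_k` one gets
`W_{K'} = W_K + (W_K)' - (W_R)'`. Multiply by `W_K^{q-1}` and integrate. The term with `(W_K)'`
gives `-W_K(0)^q/q`. Since `W_R` decreases and `W_K ≥ W_R`, the last term gives at least `W_R(0)^q/q
= W_K(0)^q/q`. Hence `∫ W_K^q ≤ ∫ W_K^{q-1} W_{K'}`, and Young's inequality yields `∫ W_K^q ≤ ∫
W_{K'}^q`, strictly because `K ≠ K'`. Each shift lowers the sum of the indices, so the process ends
at `range n`. -/

/-! ### Poisson weights and the extremal property of initial segments -/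

/-- The Poisson weight `s ^ k / k! * e ^ (-s)`. -/
def poissonWeight (k : ℕ) (s : ℝ) : ℝ := s ^ k / k.factorial * Real.exp (-s)

/-- The sum of the Poisson weights over a finite set of indices. -/
def poissonSum (K : Finset ℕ) (s : ℝ) : ℝ := ∑ k ∈ K, poissonWeight k s

/-- The derivative of `poissonWeight`. -/
def poissonWeightDeriv (k : ℕ) (s : ℝ) : ℝ :=
  (if k = 0 then 0 else poissonWeight (k - 1) s) - poissonWeight k s

theorem poissonWeight_nonneg (k : ℕ) {s : ℝ} (hs : 0 ≤ s) : 0 ≤ poissonWeight k s := by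
  unfold poissonWeight; positivity

theorem continuous_poissonWeight (k : ℕ) : Continuous (poissonWeight k) := by
  unfold poissonWeight; fun_prop

theorem poissonSum_nonneg (K : Finset ℕ) {s : ℝ} (hs : 0 ≤ s) : 0 ≤ poissonSum K s :=
  Finset.sum_nonneg fun k _ => poissonWeight_nonneg k hs

theorem continuous_poissonSum (K : Finset ℕ) : Continuous (poissonSum K) :=
  continuous_finsetSum _ fun k _ => continuous_poissonWeight k

theorem poissonSum_eq (K : Finset ℕ) (s : ℝ) :
    poissonSum K s = (∑ k ∈ K, s ^ k / k.factorial) * Real.exp (-s) := by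
  simp only [poissonSum, poissonWeight, Finset.sum_mul]

theorem poissonSum_le_one (K : Finset ℕ) {s : ℝ} (hs : 0 ≤ s) : poissonSum K s ≤ 1 := by
  rw [poissonSum_eq, Real.exp_neg, ← div_eq_mul_inv, div_le_one (Real.exp_pos s)]
  rw [Real.exp_eq_exp_ℝ, NormedSpace.exp_eq_tsum_div (𝔸 := ℝ)]
  exact (NormedSpace.expSeries_div_summable (𝔸 := ℝ) s).sum_le_tsum K fun k _ => by positivity

theorem poissonWeight_le_one (k : ℕ) {s : ℝ} (hs : 0 ≤ s) : poissonWeight k s ≤ 1 := by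
  simpa [poissonSum] using poissonSum_le_one {k} hs

theorem poissonSum_mono {K L : Finset ℕ} (h : K ⊆ L) {s : ℝ} (hs : 0 ≤ s) :
    poissonSum K s ≤ poissonSum L s :=
  Finset.sum_le_sum_of_subset_of_nonneg h fun k _ _ => poissonWeight_nonneg k hs

theorem hasDerivAt_poissonWeight (k : ℕ) (s : ℝ) :
    HasDerivAt (poissonWeight k) (poissonWeightDeriv k s) s := by
  have he : HasDerivAt (fun s : ℝ => Real.exp (-s)) (-Real.exp (-s)) s := by
    simpa using (hasDerivAt_neg s).exp
  have := (((hasDerivAt_pow k s).div_const (k.factorial : ℝ)).mul he)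
  refine this.congr_deriv ?_
  rcases k with _ | k
  · simp [poissonWeightDeriv, poissonWeight]
  · simp only [poissonWeightDeriv, poissonWeight, Nat.factorial_succ, Nat.add_sub_cancel,
      Nat.succ_ne_zero, if_false, Nat.cast_mul]
    have : (k.factorial : ℝ) ≠ 0 := by positivity
    have : ((k + 1 : ℕ) : ℝ) ≠ 0 := by positivity
    field_simp
    ring

theorem hasDerivAt_poissonSum (K : Finset ℕ) (s : ℝ) :
    HasDerivAt (poissonSum K) (∑ k ∈ K, poissonWeightDeriv k s) s :=
  HasDerivAt.fun_sum fun k _ => hasDerivAt_poissonWeight k s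

/-- The sum telescopes. This is why sums over initial segments decrease on `s ≥ 0`, which fails for
general `K`. -/
theorem sum_range_poissonWeightDeriv (n : ℕ) (s : ℝ) :
    ∑ k ∈ Finset.range (n + 1), poissonWeightDeriv k s = -poissonWeight n s := by
  induction n with
  | zero => simp [poissonWeightDeriv]
  | succ n ih =>
    rw [Finset.sum_range_succ, ih]
    simp [poissonWeightDeriv]
    ring

theorem sum_range_poissonWeightDeriv_nonpos (n : ℕ) {s : ℝ} (hs : 0 ≤ s) :
    ∑ k ∈ Finset.range n, poissonWeightDeriv k s ≤ 0 := by
  rcases n with _ | n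
  · simp
  · rw [sum_range_poissonWeightDeriv]
    linarith [poissonWeight_nonneg n hs]

/-- Raising `n` by one raises each coefficient `n - k` by one, so `G (n + 1)` is `G n + 1` minus the
Poisson sum over `range (n + 1)`, whose derivative telescopes. -/
theorem hasDerivAt_G (n : ℕ) (s : ℝ) :
    HasDerivAt (G n) (poissonSum (Finset.range n) s) s := by
  induction n with
  | zero =>
    have : G 0 = fun _ => 0 := by funext s; simp [G]
    rw [this]
    simpa [poissonSum] using hasDerivAt_const s (0 : ℝ)
  | succ n ih =>
    have : G (n + 1) = fun s => G n s + 1 - poissonSum (Finset.range (n + 1)) s := by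
      funext s
      -- The extra term `k = n` has coefficient `n - n = 0`.
      have h1 : ∑ k ∈ Finset.range (n + 1), ((n : ℝ) - k) * (s ^ k / k.factorial) * Real.exp (-s)
          = ∑ k ∈ Finset.range n, ((n : ℝ) - k) * (s ^ k / k.factorial) * Real.exp (-s) := by
        rw [Finset.sum_range_succ]; simp
      simp only [G]
      have h2 : ∑ k ∈ Finset.range (n + 1),
          (((n + 1 : ℕ) : ℝ) - k) * (s ^ k / k.factorial) * Real.exp (-s)
          = ∑ k ∈ Finset.range (n + 1), ((n : ℝ) - k) * (s ^ k / k.factorial) * Real.exp (-s)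
            + poissonSum (Finset.range (n + 1)) s := by
        rw [poissonSum, ← Finset.sum_add_distrib]
        refine Finset.sum_congr rfl fun k _ => ?_
        rw [poissonWeight]
        push_cast
        ring
      rw [h2, h1]
      push_cast
      ring
    rw [this]
    refine ((ih.add_const 1).sub (hasDerivAt_poissonSum _ s)).congr_deriv ?_
    rw [sum_range_poissonWeightDeriv, poissonSum, poissonSum, Finset.sum_range_succ]
    ring

theorem deriv_G (n : ℕ) : deriv (G n) = poissonSum (Finset.range n) :=
  funext fun s => (hasDerivAt_G n s).deriv

theorem integrableOn_poissonWeight (k : ℕ) : IntegrableOn (poissonWeight k) (Ioi 0) := by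
  have h := (Real.GammaIntegral_convergent (s := k + 1) (by positivity)).div_const
    (k.factorial : ℝ)
  refine (integrableOn_congr_fun (fun x _ => ?_) measurableSet_Ioi).mp h
  simp [poissonWeight]
  ring

theorem integral_poissonWeight (k : ℕ) : ∫ s in Ioi (0 : ℝ), poissonWeight k s = 1 := by
  have h := Real.Gamma_eq_integral (s := k + 1) (by positivity)
  rw [Real.Gamma_nat_eq_factorial] at h
  have h2 : ∀ s : ℝ, poissonWeight k s
      = (Real.exp (-s) * s ^ ((k : ℝ) + 1 - 1)) / (k.factorial : ℝ) := by
    intro s; simp [poissonWeight]; ring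
  simp_rw [h2]
  rw [integral_div, ← h, div_self (by positivity)]

theorem integrableOn_poissonSum (K : Finset ℕ) : IntegrableOn (poissonSum K) (Ioi 0) :=
  integrable_finsetSum _ fun k _ => integrableOn_poissonWeight k

theorem integrableOn_poissonWeightDeriv (k : ℕ) :
    IntegrableOn (poissonWeightDeriv k) (Ioi 0) := by
  refine Integrable.sub ?_ (integrableOn_poissonWeight k)
  split_ifs
  · exact integrable_zero _ _ _
  · exact integrableOn_poissonWeight _

theorem tendsto_poissonWeight_atTop (k : ℕ) : Tendsto (poissonWeight k) atTop (𝓝 0) := by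
  have := (Real.tendsto_pow_mul_exp_neg_atTop_nhds_zero k).div_const (k.factorial : ℝ)
  simp only [zero_div] at this
  refine this.congr fun s => ?_
  simp [poissonWeight]; ring

theorem tendsto_poissonSum_atTop (K : Finset ℕ) : Tendsto (poissonSum K) atTop (𝓝 0) := by
  have := tendsto_finsetSum K fun k _ => tendsto_poissonWeight_atTop k
  rwa [Finset.sum_const_zero] at this

theorem poissonSum_rpow_le_one (K : Finset ℕ) {s r : ℝ} (hs : 0 ≤ s) (hr : 0 ≤ r) :
    poissonSum K s ^ r ≤ 1 :=
  Real.rpow_le_one (poissonSum_nonneg K hs) (poissonSum_le_one K hs) hr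

theorem continuous_poissonSum_rpow (K : Finset ℕ) {r : ℝ} (hr : 0 ≤ r) :
    Continuous fun s => poissonSum K s ^ r :=
  (continuous_poissonSum K).rpow_const fun _ => Or.inr hr

theorem integrableOn_poissonSum_rpow_mul (K : Finset ℕ) {r : ℝ} (hr : 0 ≤ r) {g : ℝ → ℝ}
    (hg : IntegrableOn g (Ioi 0)) :
    IntegrableOn (fun s => poissonSum K s ^ r * g s) (Ioi 0) := by
  refine Integrable.bdd_mul (c := 1) hg (continuous_poissonSum_rpow K hr).aestronglyMeasurable ?_
  filter_upwards [ae_restrict_mem measurableSet_Ioi] with s hs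
  rw [Real.norm_of_nonneg (Real.rpow_nonneg (poissonSum_nonneg K (le_of_lt hs)) r)]
  exact poissonSum_rpow_le_one K (le_of_lt hs) hr

theorem poissonSum_rpow_sub_one_mul (K : Finset ℕ) {q s : ℝ} (hq : 1 < q) (hs : 0 ≤ s) :
    poissonSum K s ^ (q - 1) * poissonSum K s = poissonSum K s ^ q := by
  rcases (poissonSum_nonneg K hs).eq_or_lt with h | h
  · rw [← h, mul_zero, Real.zero_rpow (by linarith)]
  · rw [← Real.rpow_add_one h.ne', sub_add_cancel]

theorem integrableOn_poissonSum_rpow (K : Finset ℕ) {q : ℝ} (hq : 1 < q) :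
    IntegrableOn (fun s => poissonSum K s ^ q) (Ioi 0) := by
  refine (integrableOn_congr_fun (fun s hs => ?_) measurableSet_Ioi).mp
    (integrableOn_poissonSum_rpow_mul K (r := q - 1) (by linarith) (integrableOn_poissonSum K))
  exact poissonSum_rpow_sub_one_mul K hq (le_of_lt hs)

/-- The integrand is the derivative of `poissonSum K s ^ q / q`, which vanishes at infinity. -/
theorem integral_poissonSum_rpow_mul_deriv (K : Finset ℕ) {q : ℝ} (hq : 1 < q) :
    ∫ s in Ioi (0 : ℝ), poissonSum K s ^ (q - 1) * ∑ k ∈ K, poissonWeightDeriv k s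
      = -(poissonSum K 0 ^ q / q) := by
  have hint : IntegrableOn
      (fun s => poissonSum K s ^ (q - 1) * ∑ k ∈ K, poissonWeightDeriv k s) (Ioi 0) :=
    integrableOn_poissonSum_rpow_mul K (by linarith)
      (integrable_finsetSum _ fun k _ => integrableOn_poissonWeightDeriv k)
  have hlim : Tendsto (fun s => poissonSum K s ^ q / q) atTop (𝓝 0) := by
    have := ((tendsto_poissonSum_atTop K).rpow_const (p := q) (Or.inr (by linarith))).div_const q
    rwa [Real.zero_rpow (by linarith), zero_div] at this
  have h := integral_Ioi_of_hasDerivAt_of_tendsto (a := 0)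
    (f := fun s => poissonSum K s ^ q / q)
    (((continuous_poissonSum_rpow K (by linarith)).div_const q).continuousWithinAt)
    (fun s _ => ?_) hint hlim
  · rw [h, zero_sub]
  · refine (((hasDerivAt_poissonSum K s).rpow_const (Or.inr hq.le)).div_const q).congr_deriv ?_
    field_simp

/-- Keep the initial segment `range j` of `K` and lower all the indices beyond `j` by one. -/
def shiftDown (K : Finset ℕ) (j : ℕ) : Finset ℕ :=
  Finset.range j ∪ (K.filter (j < ·)).image (· - 1)

section shiftDown

variable {K : Finset ℕ} {j : ℕ}

theorem eq_range_union_filter (hsub : Finset.range j ⊆ K) (hj : j ∉ K) :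
    K = Finset.range j ∪ K.filter (j < ·) := by
  ext k
  simp only [Finset.mem_union, Finset.mem_range, Finset.mem_filter]
  constructor
  · intro hk
    rcases lt_trichotomy k j with h | h | h
    · exact Or.inl h
    · exact absurd (h ▸ hk) hj
    · exact Or.inr ⟨hk, h⟩
  · rintro (h | h)
    · exact hsub (Finset.mem_range.mpr h)
    · exact h.1

theorem disjoint_range_filter : Disjoint (Finset.range j) (K.filter (j < ·)) := by
  rw [Finset.disjoint_left]
  intro k hk hk'
  simp only [Finset.mem_range, Finset.mem_filter] at hk hk'
  omega

theorem sum_shiftDown {M : Type*} [AddCommMonoid M] (f : ℕ → M) :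
    ∑ k ∈ shiftDown K j, f k
      = ∑ k ∈ Finset.range j, f k + ∑ k ∈ K.filter (j < ·), f (k - 1) := by
  rw [shiftDown, Finset.sum_union, Finset.sum_image]
  · intro a ha b hb hab
    simp only [Finset.coe_filter, Set.mem_ofPred_eq] at ha hb hab
    omega
  · rw [Finset.disjoint_left]
    intro k hk hk'
    simp only [Finset.mem_range, Finset.mem_image, Finset.mem_filter] at hk hk'
    obtain ⟨a, ha, rfl⟩ := hk'
    omega

theorem sum_eq_range_add_filter {M : Type*} [AddCommMonoid M] (hsub : Finset.range j ⊆ K)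
    (hj : j ∉ K) (f : ℕ → M) :
    ∑ k ∈ K, f k = ∑ k ∈ Finset.range j, f k + ∑ k ∈ K.filter (j < ·), f k := by
  conv_lhs => rw [eq_range_union_filter hsub hj]
  exact Finset.sum_union disjoint_range_filter

theorem card_shiftDown (hsub : Finset.range j ⊆ K) (hj : j ∉ K) :
    (shiftDown K j).card = K.card := by
  rw [Finset.card_eq_sum_ones, Finset.card_eq_sum_ones, sum_shiftDown,
    sum_eq_range_add_filter hsub hj]

theorem sum_shiftDown_lt (hsub : Finset.range j ⊆ K) (hj : j ∉ K) (hK : K ≠ Finset.range j) :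
    ∑ k ∈ shiftDown K j, k < ∑ k ∈ K, k := by
  rw [sum_shiftDown, sum_eq_range_add_filter hsub hj]
  have hne : (K.filter (j < ·)).Nonempty := by
    rw [Finset.nonempty_iff_ne_empty]
    intro h
    apply hK
    rw [eq_range_union_filter hsub hj, h, Finset.union_empty]
  refine Nat.add_lt_add_left (Finset.sum_lt_sum_of_nonempty hne fun k hk => ?_) _
  simp only [Finset.mem_filter] at hk
  omega

/-- For `k ≥ 1` the weight of index `k - 1` is the weight of `k` plus its derivative. Shifting the
tail thus adds the derivative of the tail, written as that of `K` minus that of `range j`. -/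
theorem poissonSum_shiftDown (hsub : Finset.range j ⊆ K) (hj : j ∉ K) (s : ℝ) :
    poissonSum (shiftDown K j) s = poissonSum K s + ∑ k ∈ K, poissonWeightDeriv k s
      - ∑ k ∈ Finset.range j, poissonWeightDeriv k s := by
  rw [poissonSum, poissonSum, sum_shiftDown, sum_eq_range_add_filter hsub hj,
    sum_eq_range_add_filter hsub hj]
  have : ∑ k ∈ K.filter (j < ·), poissonWeight (k - 1) s
      = ∑ k ∈ K.filter (j < ·), poissonWeight k s
        + ∑ k ∈ K.filter (j < ·), poissonWeightDeriv k s := by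
    rw [← Finset.sum_add_distrib]
    refine Finset.sum_congr rfl fun k hk => ?_
    simp only [Finset.mem_filter] at hk
    rw [poissonWeightDeriv, if_neg (by omega)]
    ring
  rw [this]
  ring

theorem poissonSum_zero_eq (hsub : Finset.range j ⊆ K) (hj : j ∉ K) :
    poissonSum K 0 = poissonSum (Finset.range j) 0 := by
  rw [poissonSum, sum_eq_range_add_filter hsub hj, ← poissonSum, add_eq_left]
  refine Finset.sum_eq_zero fun k hk => ?_
  simp only [Finset.mem_filter] at hk
  simp [poissonWeight, show k ≠ 0 by omega]

/-- The two derivative terms from `poissonSum_shiftDown` integrate to boundary values at `0`. After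
replacing `K` by the smaller `range j` in the factor multiplying a nonpositive derivative, these
boundary values cancel. -/
theorem integral_poissonSum_rpow_le_shiftDown (hsub : Finset.range j ⊆ K) (hj : j ∉ K) {q : ℝ}
    (hq : 1 < q) :
    ∫ s in Ioi (0 : ℝ), poissonSum K s ^ q
      ≤ ∫ s in Ioi (0 : ℝ), poissonSum K s ^ (q - 1) * poissonSum (shiftDown K j) s := by
  have hq1 : 0 ≤ q - 1 := by linarith
  have hd : ∀ L : Finset ℕ, IntegrableOn (fun s => ∑ k ∈ L, poissonWeightDeriv k s) (Ioi 0) :=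
    fun L => integrable_finsetSum _ fun k _ => integrableOn_poissonWeightDeriv k
  have h1 : ∫ s in Ioi (0 : ℝ), poissonSum K s ^ (q - 1) * poissonSum (shiftDown K j) s
      = ∫ s in Ioi (0 : ℝ), (poissonSum K s ^ q
        + poissonSum K s ^ (q - 1) * ∑ k ∈ K, poissonWeightDeriv k s
        - poissonSum K s ^ (q - 1) * ∑ k ∈ Finset.range j, poissonWeightDeriv k s) := by
    refine setIntegral_congr_fun measurableSet_Ioi fun s hs => ?_
    rw [poissonSum_shiftDown hsub hj, ← poissonSum_rpow_sub_one_mul K hq (le_of_lt hs)]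
    ring
  have hA := integrableOn_poissonSum_rpow K hq
  have hB := integrableOn_poissonSum_rpow_mul K hq1 (hd K)
  have hC := integrableOn_poissonSum_rpow_mul K hq1 (hd (Finset.range j))
  have h3 : Integrable (fun s => poissonSum K s ^ q
      + poissonSum K s ^ (q - 1) * ∑ k ∈ K, poissonWeightDeriv k s)
      (volume.restrict (Ioi 0)) := hA.add hB
  rw [h1, integral_sub h3 hC, integral_add hA hB,
    integral_poissonSum_rpow_mul_deriv K hq, poissonSum_zero_eq hsub hj]
  have h2 : ∫ s in Ioi (0 : ℝ), poissonSum K s ^ (q - 1)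
        * ∑ k ∈ Finset.range j, poissonWeightDeriv k s
      ≤ ∫ s in Ioi (0 : ℝ), poissonSum (Finset.range j) s ^ (q - 1)
        * ∑ k ∈ Finset.range j, poissonWeightDeriv k s := by
    refine setIntegral_mono_on hC (integrableOn_poissonSum_rpow_mul _ hq1 (hd _))
      measurableSet_Ioi fun s hs => ?_
    refine mul_le_mul_of_nonpos_right ?_ (sum_range_poissonWeightDeriv_nonpos j (le_of_lt hs))
    exact Real.rpow_le_rpow (poissonSum_nonneg _ (le_of_lt hs))
      (poissonSum_mono hsub (le_of_lt hs)) hq1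
  rw [integral_poissonSum_rpow_mul_deriv _ hq] at h2
  linarith

end shiftDown

/-- After cancelling `e^{-s}`, two polynomials agree almost everywhere on a half-line, hence at
infinitely many points, and their coefficients recover the index sets. -/
theorem poissonSum_ae_injective {K L : Finset ℕ}
    (h : ∀ᵐ s ∂(volume.restrict (Ioi (0 : ℝ))), poissonSum K s = poissonSum L s) : K = L := by
  let P : Finset ℕ → Polynomial ℝ := fun K => ∑ k ∈ K, Polynomial.monomial k ((k.factorial : ℝ)⁻¹)
  have hP : ∀ K s, (P K).eval s = ∑ k ∈ K, s ^ k / k.factorial := by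
    intro K s
    simp [P, Polynomial.eval_finsetSum, div_eq_inv_mul]
  have hinf : Set.Infinite {s : ℝ | (P K).eval s = (P L).eval s} := by
    intro hfin
    have h0 : volume.restrict (Ioi (0 : ℝ)) {s : ℝ | ¬ poissonSum K s = poissonSum L s} = 0 := h
    have h1 : volume.restrict (Ioi (0 : ℝ)) {s : ℝ | (P K).eval s = (P L).eval s} = 0 :=
      hfin.measure_zero _
    have h2 : volume.restrict (Ioi (0 : ℝ)) univ = 0 := by
      refine measure_mono_null (fun s _ => ?_) (measure_union_null h0 h1)
      by_cases hs : (P K).eval s = (P L).eval s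
      · exact Or.inr hs
      · refine Or.inl fun hs' => hs ?_
        rw [poissonSum_eq, poissonSum_eq] at hs'
        rw [hP, hP]
        exact mul_right_cancel₀ (Real.exp_ne_zero _) hs'
    simp at h2
  have heq := Polynomial.eq_of_infinite_eval_eq _ _ hinf
  have hcoeff : ∀ K k, (P K).coeff k = if k ∈ K then ((k.factorial : ℝ)⁻¹) else 0 := by
    intro K k
    simp [P, Polynomial.finsetSum_coeff, Polynomial.coeff_monomial]
  ext k
  have hk := congrArg (fun p => Polynomial.coeff p k) heq
  simp only [hcoeff] at hk
  have : ((k.factorial : ℝ)⁻¹) ≠ 0 := by positivity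
  by_cases h1 : k ∈ K <;> by_cases h2 : k ∈ L <;>
    simp only [h1, h2, if_true, if_false] at hk ⊢
  · exact (this hk).elim
  · exact (this hk.symm).elim

/-- Integrated Young inequality with its equality case. -/
theorem integral_mul_le_young {α : Type*} {m : MeasurableSpace α} {μ : Measure α} {p q : ℝ}
    (hpq : p.HolderConjugate q) {f g : α → ℝ} (hf : ∀ᵐ x ∂μ, 0 ≤ f x) (hg : ∀ᵐ x ∂μ, 0 ≤ g x)
    (hfp : Integrable (fun x => f x ^ p) μ) (hgq : Integrable (fun x => g x ^ q) μ)
    (hfg : Integrable (fun x => f x * g x) μ) :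
    ∫ x, f x * g x ∂μ ≤ (∫ x, f x ^ p ∂μ) / p + (∫ x, g x ^ q ∂μ) / q ∧
    (∫ x, f x * g x ∂μ = (∫ x, f x ^ p ∂μ) / p + (∫ x, g x ^ q ∂μ) / q →
      ∀ᵐ x ∂μ, f x ^ p = g x ^ q) := by
  have hrhs : Integrable (fun x => f x ^ p / p + g x ^ q / q) μ :=
    (hfp.div_const p).add (hgq.div_const q)
  have hle : ∀ᵐ x ∂μ, f x * g x ≤ f x ^ p / p + g x ^ q / q := by
    filter_upwards [hf, hg] with x h1 h2 using Real.young_inequality_of_nonneg h1 h2 hpq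
  have heq : ∫ x, (f x ^ p / p + g x ^ q / q) ∂μ
      = (∫ x, f x ^ p ∂μ) / p + (∫ x, g x ^ q ∂μ) / q := by
    rw [integral_add (hfp.div_const p) (hgq.div_const q), integral_div, integral_div]
  rw [← heq]
  refine ⟨integral_mono_ae hfg hrhs hle, fun h => ?_⟩
  have := (integral_eq_iff_of_ae_le hfg hrhs hle).mp h
  filter_upwards [hf, hg, this] with x h1 h2 h3
  exact (Real.young_inequality_eq_iff_of_nonneg h1 h2 hpq).mp h3

theorem integral_poissonSum_rpow_lt_shiftDown {K : Finset ℕ} {j : ℕ} (hsub : Finset.range j ⊆ K)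
    (hj : j ∉ K) (hK : K ≠ Finset.range j) {q : ℝ} (hq : 1 < q) :
    ∫ s in Ioi (0 : ℝ), poissonSum K s ^ q
      < ∫ s in Ioi (0 : ℝ), poissonSum (shiftDown K j) s ^ q := by
  -- Young is applied to `W_K^{q-1}` and the shifted sum; the exponent `q/(q-1)` turns the first
  -- factor back into `W_K^q`.
  have hpq : (q / (q - 1)).HolderConjugate q := (Real.HolderConjugate.conjExponent hq).symm
  have hq1 : 0 < q - 1 := by linarith
  have hnn : ∀ L : Finset ℕ, ∀ᵐ s ∂(volume.restrict (Ioi (0 : ℝ))), 0 ≤ poissonSum L s := by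
    intro L
    filter_upwards [ae_restrict_mem measurableSet_Ioi] with s hs
      using poissonSum_nonneg L (le_of_lt hs)
  have hpow : ∀ s ∈ Ioi (0 : ℝ),
      (poissonSum K s ^ (q - 1)) ^ (q / (q - 1)) = poissonSum K s ^ q := by
    intro s hs
    rw [← Real.rpow_mul (poissonSum_nonneg K (le_of_lt hs)), mul_div_cancel₀ _ hq1.ne']
  have hint := integrableOn_poissonSum_rpow K hq
  obtain ⟨hle, heq⟩ := integral_mul_le_young (μ := volume.restrict (Ioi (0 : ℝ))) hpq
    (f := fun s => poissonSum K s ^ (q - 1)) (g := poissonSum (shiftDown K j))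
    ((hnn K).mono fun s hs => Real.rpow_nonneg hs _) (hnn _)
    ((integrableOn_congr_fun (fun s hs => (hpow s hs).symm) measurableSet_Ioi).mp hint)
    (integrableOn_poissonSum_rpow _ hq)
    (integrableOn_poissonSum_rpow_mul K hq1.le (integrableOn_poissonSum _))
  rw [setIntegral_congr_fun measurableSet_Ioi hpow] at hle heq
  have hmain := integral_poissonSum_rpow_le_shiftDown hsub hj hq
  have hsum := hpq.inv_add_inv_eq_one
  have hqinv : 0 < q⁻¹ := by positivity
  set I := ∫ s in Ioi (0 : ℝ), poissonSum K s ^ q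
  set I' := ∫ s in Ioi (0 : ℝ), poissonSum (shiftDown K j) s ^ q
  have hI : I = I * (q / (q - 1))⁻¹ + I * q⁻¹ := by rw [← mul_add, hsum, mul_one]
  rw [div_eq_mul_inv I, div_eq_mul_inv I'] at hle heq
  have hII' : I ≤ I' := by
    have : I * q⁻¹ ≤ I' * q⁻¹ := by linarith
    exact le_of_mul_le_mul_right this hqinv
  refine lt_of_le_of_ne hII' fun h => ?_
  rw [← h] at hle heq
  -- Equal integrals would be the equality case of Young, so the two sums agree almost everywhere
  -- and `K` is its own shift, although the shift strictly lowers the sum of the indices.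
  have hae := heq (le_antisymm hle (by linarith))
  have hKK : K = shiftDown K j := by
    apply poissonSum_ae_injective
    filter_upwards [hae, ae_restrict_mem measurableSet_Ioi] with s hs hs0
    rw [hpow s hs0] at hs
    exact (Real.rpow_left_inj (poissonSum_nonneg K (le_of_lt hs0))
      (poissonSum_nonneg _ (le_of_lt hs0)) (by linarith)).mp hs
  have := sum_shiftDown_lt hsub hj hK
  rw [← hKK] at this
  exact lt_irrefl _ this

theorem integral_poissonSum_rpow_lt {q : ℝ} (hq : 1 < q) (K : Finset ℕ)
    (hK : K ≠ Finset.range K.card) :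
    ∫ s in Ioi (0 : ℝ), poissonSum K s ^ q
      < ∫ s in Ioi (0 : ℝ), poissonSum (Finset.range K.card) s ^ q := by
  -- Shifting at the first gap keeps the cardinality and lowers the sum of the indices, so that sum
  -- is the induction parameter.
  induction hN : ∑ k ∈ K, k using Nat.strong_induction_on generalizing K with
  | _ N ih =>
    classical
    have hex : ∃ j, j ∉ K := Infinite.exists_notMem_finset K
    have hj := Nat.find_spec hex
    set j := Nat.find hex
    have hsub : Finset.range j ⊆ K := fun k hk => by
      by_contra h
      exact Nat.find_min hex (Finset.mem_range.mp hk) h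
    have hKj : K ≠ Finset.range j := fun h => hK (by rw [h, Finset.card_range])
    have hlt := integral_poissonSum_rpow_lt_shiftDown hsub hj hKj hq
    have hcard := card_shiftDown hsub hj
    by_cases h' : shiftDown K j = Finset.range (shiftDown K j).card
    · rwa [← hcard, ← h']
    · have := ih _ (hN ▸ sum_shiftDown_lt hsub hj hKj) _ h' rfl
      rw [hcard] at this
      exact hlt.trans this

theorem integral_poissonSum_rpow_le {q : ℝ} (hq : 1 < q) (K : Finset ℕ) :
    ∫ s in Ioi (0 : ℝ), poissonSum K s ^ q
      ≤ ∫ s in Ioi (0 : ℝ), poissonSum (Finset.range K.card) s ^ q := by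
  by_cases hK : K = Finset.range K.card
  · rw [← hK]
  · exact (integral_poissonSum_rpow_lt hq K hK).le

/-! ### The radial change of variables and the Gaussian measure -/

theorem volume_setOf_pi_mul_norm_sq_lt (t : ℝ) :
    volume {z : ℂ | Real.pi * ‖z‖ ^ 2 < t} = ENNReal.ofReal t := by
  rcases le_or_gt t 0 with ht | ht
  · have : {z : ℂ | Real.pi * ‖z‖ ^ 2 < t} = ∅ := by
      ext z
      simp only [Set.mem_ofPred_eq, mem_empty_iff_false, iff_false, not_lt]
      exact ht.trans (by positivity)
    rw [this, measure_empty, ENNReal.ofReal_of_nonpos ht]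
  · have : {z : ℂ | Real.pi * ‖z‖ ^ 2 < t} = Metric.ball 0 (√(t / Real.pi)) := by
      ext z
      rw [Set.mem_ofPred_eq, mem_ball_zero_iff, Real.lt_sqrt (norm_nonneg z),
        lt_div_iff₀ Real.pi_pos, mul_comm]
    rw [this, Complex.volume_ball, ← ENNReal.ofReal_pow (Real.sqrt_nonneg _),
      Real.sq_sqrt (by positivity), ← NNReal.coe_real_pi, ENNReal.ofReal_div_of_pos (by simp [Real.pi_pos]),
      ENNReal.ofReal_coe_nnreal]
    refine ENNReal.div_mul_cancel ?_ ENNReal.coe_ne_top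
    simp [NNReal.pi_ne_zero]

/-- The disc `π|z|² < t` has area exactly `t`, so both measures agree on half-open intervals. -/
theorem map_pi_mul_norm_sq_volume :
    Measure.map (fun z : ℂ => Real.pi * ‖z‖ ^ 2) volume = volume.restrict (Ioi (0 : ℝ)) := by
  have hmeas : Measurable fun z : ℂ => Real.pi * ‖z‖ ^ 2 := by fun_prop
  symm
  refine Measure.ext_of_Ico _ _ fun a b hab => ?_
  rw [Measure.map_apply hmeas measurableSet_Ico, Measure.restrict_congr_set Ioi_ae_eq_Ici,
    Measure.restrict_apply measurableSet_Ico, Ico_inter_Ici, Real.volume_Ico]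
  have hset : (fun z : ℂ => Real.pi * ‖z‖ ^ 2) ⁻¹' Ico a b
      = {z : ℂ | Real.pi * ‖z‖ ^ 2 < b} \ {z : ℂ | Real.pi * ‖z‖ ^ 2 < a} := by
    ext z
    simp [and_comm]
  have hsub : {z : ℂ | Real.pi * ‖z‖ ^ 2 < a} ⊆ {z : ℂ | Real.pi * ‖z‖ ^ 2 < b} :=
    fun z (hz : _ < a) => lt_trans hz hab
  rw [hset, measure_sdiff hsub
    (measurableSet_lt hmeas measurable_const).nullMeasurableSet
    (by rw [volume_setOf_pi_mul_norm_sq_lt]; exact ENNReal.ofReal_ne_top),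
    volume_setOf_pi_mul_norm_sq_lt, volume_setOf_pi_mul_norm_sq_lt,
    ENNReal.ofReal_sub _ (le_max_right _ _)]
  congr 1
  rcases le_total a 0 with h | h
  · simp [h, ENNReal.ofReal_of_nonpos]
  · simp [h]

theorem integral_comp_pi_mul_norm_sq {φ : ℝ → ℝ} (hφ : Continuous φ) :
    ∫ z : ℂ, φ (Real.pi * ‖z‖ ^ 2) = ∫ s in Ioi (0 : ℝ), φ s := by
  rw [← map_pi_mul_norm_sq_volume, integral_map (by fun_prop) hφ.aestronglyMeasurable]

theorem integrable_comp_pi_mul_norm_sq {φ : ℝ → ℝ} (hφ : Continuous φ)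
    (hint : IntegrableOn φ (Ioi 0)) : Integrable fun z : ℂ => φ (Real.pi * ‖z‖ ^ 2) := by
  rw [IntegrableOn, ← map_pi_mul_norm_sq_volume,
    integrable_map_measure hφ.aestronglyMeasurable (by fun_prop)] at hint
  exact hint

theorem measurable_fockDensity :
    Measurable fun z : ℂ => ENNReal.ofReal (Real.exp (-Real.pi * ‖z‖ ^ 2)) := by
  fun_prop

theorem integral_fockMeasure {E : Type*} [NormedAddCommGroup E] [NormedSpace ℝ E] (g : ℂ → E) :
    ∫ z, g z ∂fockMeasure = ∫ z : ℂ, Real.exp (-Real.pi * ‖z‖ ^ 2) • g z := by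
  rw [fockMeasure, integral_withDensity_eq_integral_toReal_smul measurable_fockDensity
    (ae_of_all _ fun z => ENNReal.ofReal_lt_top)]
  simp only [ENNReal.toReal_ofReal (Real.exp_pos _).le]

theorem integrable_fockMeasure_iff {E : Type*} [NormedAddCommGroup E] [NormedSpace ℝ E]
    {g : ℂ → E} : Integrable g fockMeasure ↔
      Integrable fun z : ℂ => Real.exp (-Real.pi * ‖z‖ ^ 2) • g z := by
  rw [fockMeasure, integrable_withDensity_iff_integrable_smul' measurable_fockDensity
    (ae_of_all _ fun z => ENNReal.ofReal_lt_top)]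
  simp only [ENNReal.toReal_ofReal (Real.exp_pos _).le]

theorem fockMeasure_absolutelyContinuous : fockMeasure ≪ (volume : Measure ℂ) :=
  withDensity_absolutelyContinuous _ _

theorem volume_absolutelyContinuous_fockMeasure : (volume : Measure ℂ) ≪ fockMeasure :=
  withDensity_absolutelyContinuous' measurable_fockDensity.aemeasurable
    (ae_of_all _ fun z => by simp [Real.exp_pos])

theorem ae_fockMeasure_iff {P : ℂ → Prop} : (∀ᵐ z ∂fockMeasure, P z) ↔ ∀ᵐ z : ℂ, P z :=
  ⟨fun h => volume_absolutelyContinuous_fockMeasure.ae_le h,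
    fun h => fockMeasure_absolutelyContinuous.ae_le h⟩

/-- The density of a monomial basis vector, expressed through the Poisson weights. -/
theorem exp_mul_norm_sq_pow (k : ℕ) (z : ℂ) :
    Real.exp (-Real.pi * ‖z‖ ^ 2) * (Real.pi ^ k / k.factorial * ‖z‖ ^ (2 * k))
      = poissonWeight k (Real.pi * ‖z‖ ^ 2) := by
  rw [poissonWeight, mul_pow, pow_mul, neg_mul]
  ring

theorem integral_poissonWeight_comp (k : ℕ) :
    ∫ z : ℂ, poissonWeight k (Real.pi * ‖z‖ ^ 2) = 1 := by
  rw [integral_comp_pi_mul_norm_sq (continuous_poissonWeight k), integral_poissonWeight]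

theorem integrable_poissonWeight_comp (k : ℕ) :
    Integrable fun z : ℂ => poissonWeight k (Real.pi * ‖z‖ ^ 2) :=
  integrable_comp_pi_mul_norm_sq (continuous_poissonWeight k) (integrableOn_poissonWeight k)

theorem integrable_exp_neg_pi_mul_norm_sq :
    Integrable fun z : ℂ => Real.exp (-Real.pi * ‖z‖ ^ 2) := by
  simpa [poissonWeight] using integrable_poissonWeight_comp 0

theorem integral_exp_neg_pi_mul_norm_sq :
    ∫ z : ℂ, Real.exp (-Real.pi * ‖z‖ ^ 2) = 1 := by
  simpa [poissonWeight] using integral_poissonWeight_comp 0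

instance isProbabilityMeasure_fockMeasure : IsProbabilityMeasure fockMeasure := by
  constructor
  rw [fockMeasure, withDensity_apply _ MeasurableSet.univ, Measure.restrict_univ,
    ← ofReal_integral_eq_lintegral_ofReal integrable_exp_neg_pi_mul_norm_sq
      (ae_of_all _ fun z => (Real.exp_pos _).le), integral_exp_neg_pi_mul_norm_sq]
  simp

/-! ### Taylor coefficients as radial averages -/

/-- The `k`-th Taylor coefficient at the origin. -/
def taylorCoeff (F : ℂ → ℂ) (k : ℕ) : ℂ := iteratedDeriv k F 0 / k.factorial

theorem integral_circle_mul {F : ℂ → ℂ} (hF : Differentiable ℂ F) (k : ℕ) (z : ℂ) :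
    ∫ t in (0 : ℝ)..2 * Real.pi,
        Complex.exp (-(k * t * Complex.I)) * F (Complex.exp (t * Complex.I) * z)
      = 2 * Real.pi * (taylorCoeff F k * z ^ k) := by
  -- Cauchy's formula is used for `w ↦ F (z * w)` on the unit circle rather than for `F` on the
  -- circle of radius `|z|`; this covers `z = 0` as well.
  have hf : Differentiable ℂ fun w : ℂ => F (z * w) := hF.comp (differentiable_id.const_mul z)
  have h := DifferentiableOn.circleIntegral_one_div_sub_center_pow_smul (c := (0 : ℂ)) (R := 1)
    one_pos k hf.differentiableOn
  have hit : iteratedDeriv k (fun w : ℂ => F (z * w)) 0 = z ^ k * iteratedDeriv k F 0 := by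
    have := iteratedDeriv_comp_const_mul (n := k) (f := F) hF.contDiff z
    rw [this]
    simp
  rw [hit, circleIntegral] at h
  have hI : Complex.I ≠ 0 := Complex.I_ne_zero
  have h2 : ∀ t : ℝ, deriv (circleMap 0 1) t •
      ((1 / (circleMap 0 1 t - 0) ^ (k + 1)) • F (z * circleMap 0 1 t))
      = Complex.I * (Complex.exp (-(k * t * Complex.I)) * F (Complex.exp (t * Complex.I) * z)) := by
    intro t
    have he : Complex.exp (-(k * t * Complex.I)) = (Complex.exp (t * Complex.I) ^ k)⁻¹ := by
      rw [← Complex.exp_nat_mul, ← Complex.exp_neg]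
      ring_nf
    rw [he, deriv_circleMap, circleMap_zero, mul_comm z]
    have := Complex.exp_ne_zero (t * Complex.I)
    simp only [smul_eq_mul, Complex.ofReal_one, one_mul, sub_zero]
    field_simp
    ring
  simp_rw [h2] at h
  rw [intervalIntegral.integral_const_mul] at h
  refine mul_left_cancel₀ hI (h.trans ?_)
  rw [taylorCoeff, smul_eq_mul]
  ring

/-- Rotating the variable changes neither the integral nor `w`. Averaging over all angles and
exchanging the integrals leaves, at each `z`, a circle integral that isolates the `k`-th Taylor term
of `F`. -/
theorem integral_radial_mul {w F : ℂ → ℂ} (hw : AEStronglyMeasurable w volume)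
    (hrot : ∀ t : ℝ, ∀ᵐ z : ℂ, w (Complex.exp (t * Complex.I) * z) = w z)
    (hF : Differentiable ℂ F) (k : ℕ)
    (hint : Integrable fun z : ℂ => w z * (starRingEnd ℂ z ^ k * F z)) :
    ∫ z : ℂ, w z * (starRingEnd ℂ z ^ k * F z)
      = taylorCoeff F k * ∫ z : ℂ, w z * (starRingEnd ℂ z ^ k * z ^ k) := by
  set Φ : ℂ → ℂ := fun z => w z * (starRingEnd ℂ z ^ k * F z) with hΦ
  let Ψ : ℝ → ℂ → ℂ := fun t z => w z * (starRingEnd ℂ z ^ k *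
    (Complex.exp (-(k * t * Complex.I)) * F (Complex.exp (t * Complex.I) * z)))
  let R : ℝ → ℂ ≃ₗᵢ[ℝ] ℂ := fun t => rotation (Circle.exp t)
  have hR : ∀ t z, R t z = Complex.exp (t * Complex.I) * z := fun t z => by
    simp [R, rotation_apply, Circle.coe_exp]
  have hmp : ∀ t, MeasurePreserving (R t) volume volume := fun t => (R t).measurePreserving
  have hemb : ∀ t, MeasurableEmbedding (R t) :=
    fun t => (R t).toHomeomorph.measurableEmbedding
  have hae : ∀ t, (fun z => Φ (R t z)) =ᵐ[volume] Ψ t := by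
    intro t
    filter_upwards [hrot t] with z hz
    have he : starRingEnd ℂ (Complex.exp (t * Complex.I)) ^ k
        = Complex.exp (-(k * t * Complex.I)) := by
      rw [← Complex.exp_conj, ← Complex.exp_nat_mul]
      simp only [map_mul, Complex.conj_ofReal, Complex.conj_I]
      ring_nf
    simp only [hΦ, Ψ, hR, hz, map_mul, mul_pow, he]
    ring
  have hΨint : ∀ t, Integrable (Ψ t) volume := fun t =>
    (((hmp t).integrable_comp_emb (hemb t)).mpr hint).congr (hae t)
  have hΨval : ∀ t, ∫ z, Ψ t z = ∫ z, Φ z := fun t => by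
    rw [← integral_congr_ae (hae t), (hmp t).integral_comp (hemb t) Φ]
  have hΨnorm : ∀ t, ∫ z, ‖Ψ t z‖ = ∫ z, ‖Φ z‖ := fun t => by
    rw [← (hmp t).integral_comp (hemb t) fun z => ‖Φ z‖]
    exact integral_congr_ae ((hae t).mono fun z hz => by simp only [← hz])
  have hFc := hF.continuous
  have hprod : Integrable (Function.uncurry Ψ)
      ((volume.restrict (Ioc (0 : ℝ) (2 * Real.pi))).prod volume) := by
    have hmeas : AEStronglyMeasurable (Function.uncurry Ψ)
        ((volume.restrict (Ioc (0 : ℝ) (2 * Real.pi))).prod volume) := by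
      refine AEStronglyMeasurable.mul (hw.comp_snd) ?_
      refine Continuous.aestronglyMeasurable ?_
      fun_prop
    refine (integrable_prod_iff hmeas).mpr ⟨ae_of_all _ fun t => hΨint t, ?_⟩
    simp only [Function.uncurry, hΨnorm]
    exact integrable_const _
  have hswap := integral_integral_swap hprod
  simp only [hΨval] at hswap
  rw [integral_const] at hswap
  have hinner : ∀ z : ℂ, ∫ t in Ioc (0 : ℝ) (2 * Real.pi), Ψ t z
      = 2 * Real.pi * (taylorCoeff F k * (w z * (starRingEnd ℂ z ^ k * z ^ k))) := by
    intro z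
    simp only [Ψ]
    rw [integral_const_mul, integral_const_mul, ← intervalIntegral.integral_of_le (by positivity),
      integral_circle_mul hF]
    ring
  simp only [hinner] at hswap
  rw [integral_const_mul, integral_const_mul] at hswap
  have hpi : (2 * Real.pi : ℂ) ≠ 0 := by simp [Real.pi_ne_zero]
  refine mul_left_cancel₀ hpi (Eq.trans ?_ hswap)
  simp [Real.pi_pos.le]

/-! ### The pointwise bound and completeness -/

/-- By rotation averaging, `F 0` is the mean of `F` for the Gaussian probability measure;
nonnegativity of the variance of `‖F‖` does the rest. -/
theorem sq_norm_le_of_entire {F : ℂ → ℂ} (hF : Differentiable ℂ F)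
    (hint : Integrable (fun z => ‖F z‖ ^ 2) fockMeasure) :
    ‖F 0‖ ^ 2 ≤ ∫ z, ‖F z‖ ^ 2 ∂fockMeasure := by
  have hFc := hF.continuous
  have hnorm : Integrable (fun z => ‖F z‖) fockMeasure := by
    refine ((integrable_const (1 : ℝ)).add hint).mono' (by fun_prop) (ae_of_all _ fun z => ?_)
    simp only [norm_norm, Pi.add_apply]
    nlinarith [sq_nonneg (‖F z‖ - 1), norm_nonneg (F z)]
  have hFint : Integrable F fockMeasure := (integrable_norm_iff (by fun_prop)).mp hnorm
  have hmean : ∫ z, F z ∂fockMeasure = F 0 := by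
    have h := integral_radial_mul (w := fun z => (Real.exp (-Real.pi * ‖z‖ ^ 2) : ℂ)) (F := F)
      (by fun_prop) (fun t => ae_of_all _ fun z => by
        simp [Complex.norm_exp_ofReal_mul_I]) hF 0 (by
        have := integrable_fockMeasure_iff.mp hFint
        simpa [Complex.real_smul] using this)
    rw [integral_fockMeasure]
    have h1 : ∫ z : ℂ, (Real.exp (-Real.pi * ‖z‖ ^ 2) : ℂ) = 1 := by
      rw [integral_complex_ofReal, integral_exp_neg_pi_mul_norm_sq, Complex.ofReal_one]
    simp only [pow_zero, mul_one, one_mul, h1, taylorCoeff, iteratedDeriv_zero,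
      Nat.factorial_zero, Nat.cast_one, div_one] at h
    simpa only [Complex.real_smul] using h
  set m := ∫ z, ‖F z‖ ∂fockMeasure with hm
  have hm0 : ‖F 0‖ ≤ m := by
    rw [← hmean]
    exact norm_integral_le_integral_norm _
  have hvar : 0 ≤ ∫ z, (‖F z‖ ^ 2 - 2 * m * ‖F z‖ + m ^ 2) ∂fockMeasure := by
    refine integral_nonneg fun z => ?_
    have := sq_nonneg (‖F z‖ - m)
    simp only [Pi.zero_apply]
    linarith
  have hi2 : Integrable (fun z => ‖F z‖ ^ 2 - 2 * m * ‖F z‖) fockMeasure :=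
    hint.sub (hnorm.const_mul _)
  rw [integral_add hi2 (integrable_const _),
    integral_sub hint (hnorm.const_mul _), integral_const_mul, ← hm] at hvar
  simp only [integral_const, probReal_univ, smul_eq_mul, one_mul] at hvar
  nlinarith [norm_nonneg (F 0)]

theorem sq_norm_mul_exp_le_of_entire {F : ℂ → ℂ} (hF : Differentiable ℂ F)
    (hint : Integrable (fun z => ‖F z‖ ^ 2) fockMeasure) (z : ℂ) :
    Real.exp (-Real.pi * ‖z‖ ^ 2) * ‖F z‖ ^ 2 ≤ ∫ z, ‖F z‖ ^ 2 ∂fockMeasure := by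
  -- This is a Weyl translation: the exponential factor absorbs the cross term of `‖w + z‖ ^ 2`, so
  -- the bound at the origin moves to `z`.
  let H : ℂ → ℂ := fun w => F (w + z) * Complex.exp (-Real.pi * (starRingEnd ℂ z * w))
  have hH : Differentiable ℂ H := by
    refine (hF.comp (differentiable_id.add_const z)).mul ?_
    fun_prop
  have hweight : ∀ w, Real.exp (-Real.pi * ‖w‖ ^ 2) * ‖H w‖ ^ 2
      = Real.exp (Real.pi * ‖z‖ ^ 2) * (Real.exp (-Real.pi * ‖w + z‖ ^ 2) * ‖F (w + z)‖ ^ 2) := by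
    intro w
    have hexp : ‖Complex.exp (-Real.pi * (starRingEnd ℂ z * w))‖
        = Real.exp (-Real.pi * (z.re * w.re + z.im * w.im)) := by
      rw [Complex.norm_exp]
      congr 1
      rw [← Complex.ofReal_neg, Complex.re_ofReal_mul]
      simp
    have hn : ‖w + z‖ ^ 2 = ‖w‖ ^ 2 + ‖z‖ ^ 2 + 2 * (z.re * w.re + z.im * w.im) := by
      simp only [← Complex.normSq_eq_norm_sq, Complex.normSq_apply, Complex.add_re, Complex.add_im]
      ring
    simp only [H, norm_mul, hexp, mul_pow, hn]
    rw [← Real.exp_nat_mul, ← mul_assoc (Real.exp (Real.pi * _)), ← Real.exp_add,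
      mul_left_comm, ← Real.exp_add, mul_comm (‖F (w + z)‖ ^ 2)]
    congr 2
    push_cast
    ring
  have hint' := integrable_fockMeasure_iff.mp hint
  simp only [smul_eq_mul] at hint'
  have hHint : Integrable (fun w => ‖H w‖ ^ 2) fockMeasure := by
    rw [integrable_fockMeasure_iff]
    simp only [smul_eq_mul, hweight]
    exact (hint'.comp_add_right z).const_mul _
  have h := sq_norm_le_of_entire hH hHint
  rw [integral_fockMeasure] at h
  simp only [smul_eq_mul, hweight] at h
  rw [integral_const_mul, integral_add_right_eq_self
    (fun w : ℂ => Real.exp (-Real.pi * ‖w‖ ^ 2) * ‖F w‖ ^ 2) z] at h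
  rw [integral_fockMeasure]
  simp only [smul_eq_mul]
  have hH0 : H 0 = F z := by simp [H]
  rw [hH0] at h
  calc Real.exp (-Real.pi * ‖z‖ ^ 2) * ‖F z‖ ^ 2
      ≤ Real.exp (-Real.pi * ‖z‖ ^ 2) * (Real.exp (Real.pi * ‖z‖ ^ 2) *
        ∫ w : ℂ, Real.exp (-Real.pi * ‖w‖ ^ 2) * ‖F w‖ ^ 2) := by gcongr
    _ = ∫ w : ℂ, Real.exp (-Real.pi * ‖w‖ ^ 2) * ‖F w‖ ^ 2 := by
      rw [← mul_assoc, ← Real.exp_add, neg_mul, neg_add_cancel, Real.exp_zero, one_mul]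

/-- The entire function representing an element of the Fock space. -/
def entireRep (f : fockSpace) : ℂ → ℂ := f.2.choose

theorem differentiable_entireRep (f : fockSpace) : Differentiable ℂ (entireRep f) :=
  f.2.choose_spec.1

theorem coe_ae_eq_entireRep (f : fockSpace) :
    ((f : Lp ℂ 2 fockMeasure) : ℂ → ℂ) =ᵐ[fockMeasure] entireRep f :=
  f.2.choose_spec.2

theorem sq_norm_eq_integral (f : Lp ℂ 2 fockMeasure) :
    ‖f‖ ^ 2 = ∫ z, ‖f z‖ ^ 2 ∂fockMeasure := by
  have h : inner ℂ f f = ∫ z, inner ℂ (f z) (f z) ∂fockMeasure := L2.inner_def f f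
  have h2 : ∀ z, inner ℂ (f z) (f z) = ((‖f z‖ ^ 2 : ℝ) : ℂ) := fun z => by
    rw [inner_self_eq_norm_sq_to_K]; simp
  simp only [h2] at h
  rw [integral_complex_ofReal, inner_self_eq_norm_sq_to_K] at h
  rw [← Complex.ofReal_inj, ← h]
  simp

theorem integrable_sq_norm (f : Lp ℂ 2 fockMeasure) :
    Integrable (fun z => ‖f z‖ ^ 2) fockMeasure :=
  (memLp_two_iff_integrable_sq_norm (Lp.aestronglyMeasurable f)).mp (Lp.memLp f)

theorem exp_mul_sq_norm_le (f : Lp ℂ 2 fockMeasure) {F : ℂ → ℂ} (hF : Differentiable ℂ F)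
    (hf : f =ᵐ[fockMeasure] F) (z : ℂ) :
    Real.exp (-Real.pi * ‖z‖ ^ 2) * ‖F z‖ ^ 2 ≤ ‖f‖ ^ 2 := by
  have hae : (fun z => ‖f z‖ ^ 2) =ᵐ[fockMeasure] fun z => ‖F z‖ ^ 2 :=
    hf.mono fun z hz => by simp only [hz]
  rw [sq_norm_eq_integral, integral_congr_ae hae]
  exact sq_norm_mul_exp_le_of_entire hF ((integrable_sq_norm f).congr hae) z

/-- The exponent is twice the sharp one, which avoids square roots; only a locally bounded factor is
needed for locally uniform convergence. -/
theorem norm_le_exp_mul (f : Lp ℂ 2 fockMeasure) {F : ℂ → ℂ} (hF : Differentiable ℂ F)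
    (hf : f =ᵐ[fockMeasure] F) (z : ℂ) :
    ‖F z‖ ≤ Real.exp (Real.pi * ‖z‖ ^ 2) * ‖f‖ := by
  have h := exp_mul_sq_norm_le f hF hf z
  have he : Real.exp (Real.pi * ‖z‖ ^ 2) * Real.exp (-Real.pi * ‖z‖ ^ 2) = 1 := by
    rw [← Real.exp_add, neg_mul, add_neg_cancel, Real.exp_zero]
  have h1 : 1 ≤ Real.exp (Real.pi * ‖z‖ ^ 2) := Real.one_le_exp (by positivity)
  refine le_of_sq_le_sq ?_ (by positivity)
  calc ‖F z‖ ^ 2 = Real.exp (Real.pi * ‖z‖ ^ 2)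
        * (Real.exp (-Real.pi * ‖z‖ ^ 2) * ‖F z‖ ^ 2) := by rw [← mul_assoc, he, one_mul]
    _ ≤ Real.exp (Real.pi * ‖z‖ ^ 2) * ‖f‖ ^ 2 := by gcongr
    _ ≤ Real.exp (Real.pi * ‖z‖ ^ 2) ^ 2 * ‖f‖ ^ 2 := by
      gcongr
      exact le_self_pow₀ h1 two_ne_zero
    _ = (Real.exp (Real.pi * ‖z‖ ^ 2) * ‖f‖) ^ 2 := by ring

/-- Norm convergence forces locally uniform convergence of the entire representatives, whose limit
is entire; an almost everywhere convergent subsequence identifies it with the `L²` limit. The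
resulting completeness is what allows operators to be built from bounded sesquilinear forms. -/
theorem isClosed_fockSpace : IsClosed (fockSpace : Set (Lp ℂ 2 fockMeasure)) := by
  refine IsSeqClosed.isClosed fun f g hf hg => ?_
  choose F hF hfF using hf
  have hdiff : ∀ m n z, ‖F m z - F n z‖ ≤ Real.exp (Real.pi * ‖z‖ ^ 2) * ‖f m - f n‖ := by
    intro m n z
    refine norm_le_exp_mul (f m - f n) ((hF m).sub (hF n)) ?_ z
    exact (Lp.coeFn_sub _ _).trans ((hfF m).sub (hfF n))
  have hcauchy : ∀ z, CauchySeq fun n => F n z := by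
    intro z
    have hc := hg.cauchySeq
    rw [Metric.cauchySeq_iff] at hc ⊢
    intro ε hε
    obtain ⟨N, hN⟩ := hc (ε / Real.exp (Real.pi * ‖z‖ ^ 2)) (by positivity)
    refine ⟨N, fun m hm n hn => ?_⟩
    have := hN m hm n hn
    rw [dist_eq_norm] at this ⊢
    refine (hdiff m n z).trans_lt ?_
    rwa [lt_div_iff₀' (Real.exp_pos _)] at this
  choose F' hF' using fun z => cauchySeq_tendsto_of_complete (hcauchy z)
  have hlim : ∀ m z, ‖F m z - F' z‖ ≤ Real.exp (Real.pi * ‖z‖ ^ 2) * ‖f m - g‖ := by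
    intro m z
    refine le_of_tendsto_of_tendsto' ((tendsto_const_nhds.sub (hF' z)).norm)
      ((tendsto_const_nhds.sub hg).norm.const_mul _) fun n => hdiff m n z
  refine ⟨F', fun z => ?_, ?_⟩
  · have hunif : TendstoUniformlyOn F F' atTop (Metric.ball 0 (‖z‖ + 1)) := by
      rw [Metric.tendstoUniformlyOn_iff]
      intro ε hε
      set C := Real.exp (Real.pi * (‖z‖ + 1) ^ 2) with hC
      have h0 : Tendsto (fun n => C * ‖f n - g‖) atTop (𝓝 0) := by
        have := (hg.sub_const g).norm.const_mul C
        simpa using this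
      filter_upwards [h0.eventually (gt_mem_nhds hε)] with n hn w hw
      rw [dist_comm, dist_eq_norm]
      refine (hlim n w).trans_lt (lt_of_le_of_lt ?_ hn)
      rw [mem_ball_zero_iff] at hw
      refine mul_le_mul_of_nonneg_right ?_ (norm_nonneg _)
      rw [hC]
      gcongr
    have hdo := hunif.tendstoLocallyUniformlyOn.differentiableOn
      (Eventually.of_forall fun n => (hF n).differentiableOn) Metric.isOpen_ball
    exact hdo.differentiableAt (Metric.isOpen_ball.mem_nhds (by simp))
  · obtain ⟨ns, hns, hae⟩ := (tendstoInMeasure_of_tendsto_Lp hg).exists_seq_tendsto_ae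
    filter_upwards [hae, ae_all_iff.mpr hfF] with z hz1 hz2
    refine tendsto_nhds_unique hz1 ?_
    simp only [hz2]
    exact (hF' z).comp hns.tendsto_atTop

instance completeSpace_fockSpace : CompleteSpace fockSpace :=
  isClosed_fockSpace.completeSpace_coe

/-! ### The monomial basis -/

/-- The normalization of the monomial `z ^ k`. -/
def monomialNorm (k : ℕ) : ℝ := √(Real.pi ^ k / k.factorial)

theorem monomialNorm_pos (k : ℕ) : 0 < monomialNorm k :=
  Real.sqrt_pos.mpr (by have := Real.pi_pos; positivity)

theorem monomialNorm_sq (k : ℕ) : monomialNorm k ^ 2 = Real.pi ^ k / k.factorial :=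
  Real.sq_sqrt (by have := Real.pi_pos; positivity)

/-- The normalized monomial. -/
def fockMonomial (k : ℕ) (z : ℂ) : ℂ := monomialNorm k * z ^ k

theorem differentiable_fockMonomial (k : ℕ) : Differentiable ℂ (fockMonomial k) := by
  unfold fockMonomial; fun_prop

theorem exp_mul_sq_norm_fockMonomial (k : ℕ) (z : ℂ) :
    Real.exp (-Real.pi * ‖z‖ ^ 2) * ‖fockMonomial k z‖ ^ 2
      = poissonWeight k (Real.pi * ‖z‖ ^ 2) := by
  rw [← exp_mul_norm_sq_pow, fockMonomial, norm_mul, mul_pow, Complex.norm_real, norm_pow,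
    Real.norm_of_nonneg (monomialNorm_pos k).le, monomialNorm_sq, ← pow_mul, mul_comm k 2]

theorem memLp_fockMonomial (k : ℕ) : MemLp (fockMonomial k) 2 fockMeasure := by
  rw [memLp_two_iff_integrable_sq_norm
    (differentiable_fockMonomial k).continuous.aestronglyMeasurable, integrable_fockMeasure_iff]
  simp only [smul_eq_mul, exp_mul_sq_norm_fockMonomial]
  exact integrable_poissonWeight_comp k

/-- The normalized monomial as an element of the Fock space. -/
def fockBasis (k : ℕ) : fockSpace :=
  ⟨(memLp_fockMonomial k).toLp, fockMonomial k, differentiable_fockMonomial k, (memLp_fockMonomial k).coeFn_toLp⟩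

theorem coe_fockBasis (k : ℕ) :
    ((fockBasis k : Lp ℂ 2 fockMeasure) : ℂ → ℂ) =ᵐ[fockMeasure] fockMonomial k :=
  (memLp_fockMonomial k).coeFn_toLp

/-- The diagonal entries of the Toeplitz operator with a radial symbol. -/
def symbolMoment (σ : ℂ → ℝ) (k : ℕ) : ℝ := ∫ z : ℂ, σ z * poissonWeight k (Real.pi * ‖z‖ ^ 2)

theorem integral_radial_inner_fockMonomial {σ : ℂ → ℝ} (hσ : AEStronglyMeasurable σ volume)
    (hrot : ∀ t : ℝ, ∀ᵐ z : ℂ, σ (Complex.exp (t * Complex.I) * z) = σ z)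
    {F : ℂ → ℂ} (hF : Differentiable ℂ F) (k : ℕ)
    (hint : Integrable (fun z => (σ z : ℂ) * inner ℂ (fockMonomial k z) (F z)) fockMeasure) :
    ∫ z, (σ z : ℂ) * inner ℂ (fockMonomial k z) (F z) ∂fockMeasure
      = symbolMoment σ k * (taylorCoeff F k / monomialNorm k) := by
  let w : ℂ → ℂ := fun z => ((Real.exp (-Real.pi * ‖z‖ ^ 2) * σ z : ℝ) : ℂ)
  have hw : AEStronglyMeasurable w volume :=
    Complex.continuous_ofReal.comp_aestronglyMeasurable
      (AEStronglyMeasurable.mul (by fun_prop) hσ)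
  have hwrot : ∀ t : ℝ, ∀ᵐ z : ℂ, w (Complex.exp (t * Complex.I) * z) = w z := fun t => by
    filter_upwards [hrot t] with z hz
    simp only [w, hz, norm_mul, Complex.norm_exp_ofReal_mul_I, one_mul]
  have hc : (monomialNorm k : ℂ) ≠ 0 := by exact_mod_cast (monomialNorm_pos k).ne'
  have hpt : ∀ z : ℂ, Real.exp (-Real.pi * ‖z‖ ^ 2) • ((σ z : ℂ) *
      inner ℂ (fockMonomial k z) (F z))
      = monomialNorm k * (w z * (starRingEnd ℂ z ^ k * F z)) := by
    intro z
    simp only [RCLike.inner_apply, fockMonomial, map_mul, map_pow, Complex.conj_ofReal, w,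
      Complex.real_smul, Complex.ofReal_mul]
    ring
  rw [integrable_fockMeasure_iff] at hint
  simp only [hpt] at hint
  have hint' : Integrable fun z => w z * (starRingEnd ℂ z ^ k * F z) := by
    refine (hint.const_mul (monomialNorm k : ℂ)⁻¹).congr (ae_of_all _ fun z => ?_)
    simp only
    rw [← mul_assoc, inv_mul_cancel₀ hc, one_mul]
  have hwz : ∀ z : ℂ, w z * (starRingEnd ℂ z ^ k * z ^ k)
      = ((((monomialNorm k) ^ 2)⁻¹ * (σ z * poissonWeight k (Real.pi * ‖z‖ ^ 2)) : ℝ) : ℂ) := by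
    intro z
    have hzz : starRingEnd ℂ z ^ k * z ^ k = ((‖z‖ ^ (2 * k) : ℝ) : ℂ) := by
      rw [← mul_pow, mul_comm, Complex.mul_conj, Complex.normSq_eq_norm_sq, pow_mul]
      push_cast
      rfl
    rw [hzz, ← exp_mul_norm_sq_pow, ← Complex.ofReal_mul, ← monomialNorm_sq]
    congr 1
    have := (monomialNorm_pos k).ne'
    field_simp
  rw [integral_fockMeasure]
  simp only [hpt]
  rw [integral_const_mul, integral_radial_mul hw hwrot hF k hint']
  simp only [hwz]
  rw [integral_complex_ofReal, integral_const_mul, ← symbolMoment]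
  push_cast
  field_simp

theorem symbolMoment_one (k : ℕ) : symbolMoment (fun _ => 1) k = 1 := by
  simp [symbolMoment, integral_poissonWeight_comp]

theorem inner_congr_ae {f g : Lp ℂ 2 fockMeasure} {F H : ℂ → ℂ} (hf : f =ᵐ[fockMeasure] F)
    (hg : g =ᵐ[fockMeasure] H) (σ : ℂ → ℝ) :
    (fun z => (σ z : ℂ) * inner ℂ (f z) (g z)) =ᵐ[fockMeasure]
      fun z => (σ z : ℂ) * inner ℂ (F z) (H z) := by
  filter_upwards [hf, hg] with z h1 h2
  rw [h1, h2]

theorem inner_fockBasis (f : fockSpace) {F : ℂ → ℂ} (hF : Differentiable ℂ F)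
    (hf : ((f : Lp ℂ 2 fockMeasure) : ℂ → ℂ) =ᵐ[fockMeasure] F) (k : ℕ) :
    inner ℂ (fockBasis k) f = taylorCoeff F k / monomialNorm k := by
  have hcongr := inner_congr_ae (coe_fockBasis k) hf fun _ => 1
  have h := integral_radial_inner_fockMonomial (σ := fun _ => 1) (by fun_prop)
    (fun t => ae_of_all _ fun z => rfl) hF k (Integrable.congr (by
      simpa using L2.integrable_inner (𝕜 := ℂ) (fockBasis k : Lp ℂ 2 fockMeasure)
        (f : Lp ℂ 2 fockMeasure)) hcongr)
  rw [← integral_congr_ae hcongr, symbolMoment_one] at h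
  rw [Submodule.coe_inner, L2.inner_def]
  simpa using h

theorem taylorCoeff_fockMonomial (j k : ℕ) :
    taylorCoeff (fockMonomial j) k = if k = j then (monomialNorm j : ℂ) else 0 := by
  have h : iteratedDeriv k (fockMonomial j) 0
      = monomialNorm j * ((if k = j then j.factorial else 0 : ℕ) : ℂ) := by
    have := iteratedDeriv_const_mul_field (n := k) (x := (0 : ℂ)) (monomialNorm j : ℂ)
      (fun z : ℂ => z ^ j)
    rw [iteratedDeriv_fun_pow_zero] at this
    exact this
  rw [taylorCoeff, h]
  split_ifs with hkj
  · subst hkj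
    have : (k.factorial : ℂ) ≠ 0 := by exact_mod_cast k.factorial_ne_zero
    field_simp
  · simp

theorem orthonormal_fockBasis : Orthonormal ℂ fockBasis := by
  rw [orthonormal_iff_ite]
  intro k j
  rw [inner_fockBasis _ (differentiable_fockMonomial j) (coe_fockBasis j),
    taylorCoeff_fockMonomial]
  split_ifs with h
  · subst h
    exact div_self (by exact_mod_cast (monomialNorm_pos k).ne')
  · simp

/-- The inner products are nonzero multiples of the Taylor coefficients, and an entire function is
the sum of its Taylor series. -/
theorem eq_zero_of_inner_fockBasis_eq_zero (f : fockSpace)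
    (h : ∀ k, inner ℂ (fockBasis k) f = 0) : f = 0 := by
  have hF := differentiable_entireRep f
  have hcoeff : ∀ k, iteratedDeriv k (entireRep f) 0 = 0 := by
    intro k
    have := h k
    rw [inner_fockBasis f hF (coe_ae_eq_entireRep f), taylorCoeff] at this
    have hc : (monomialNorm k : ℂ) ≠ 0 := by exact_mod_cast (monomialNorm_pos k).ne'
    have hk : (k.factorial : ℂ) ≠ 0 := by exact_mod_cast k.factorial_ne_zero
    simpa [hc, hk] using this
  have hzero : ∀ z, entireRep f z = 0 := by
    intro z
    rw [← Complex.taylorSeries_eq_of_entire hF 0 z]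
    simp [hcoeff]
  apply Subtype.ext
  apply Lp.ext
  refine (coe_ae_eq_entireRep f).trans ?_
  refine EventuallyEq.trans (ae_of_all _ hzero) ?_
  exact (Lp.coeFn_zero _ _ _).symm

/-! ### Toeplitz operators with nonnegative symbols in `L^p` -/

/-- Above the level `δ`, `x = x^{1-p} x^p` with `x^{1-p} ≤ δ^{1-p}`. The value `δ = 1` serves for
integrability, a small `δ` for the decay of the moments. -/
theorem le_add_rpow_mul_rpow {p x δ : ℝ} (hp : 1 < p) (hx : 0 ≤ x) (hδ : 0 < δ) :
    x ≤ δ + δ ^ (1 - p) * x ^ p := by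
  rcases le_or_gt x δ with h | h
  · have : 0 ≤ δ ^ (1 - p) * x ^ p := by positivity
    linarith
  · have hx0 : 0 < x := hδ.trans h
    have h1 : x = x ^ (1 - p) * x ^ p := by
      rw [← Real.rpow_add hx0, sub_add_cancel, Real.rpow_one]
    have h2 : x ^ (1 - p) ≤ δ ^ (1 - p) :=
      Real.rpow_le_rpow_of_nonpos hδ h.le (by linarith)
    calc x = x ^ (1 - p) * x ^ p := h1
      _ ≤ δ ^ (1 - p) * x ^ p := by gcongr
      _ ≤ δ + δ ^ (1 - p) * x ^ p := by linarith

theorem integrable_rpow_of_memLp {p : ℝ} (hp : 1 < p) {σ : ℂ → ℝ}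
    (hσ : MemLp σ (ENNReal.ofReal p) volume) (hσ0 : ∀ᵐ z : ℂ, 0 ≤ σ z) :
    Integrable fun z => σ z ^ p := by
  have h := hσ.integrable_norm_rpow (by simpa using by linarith) ENNReal.ofReal_ne_top
  rw [ENNReal.toReal_ofReal (by linarith)] at h
  refine h.congr ?_
  filter_upwards [hσ0] with z hz
  rw [Real.norm_of_nonneg hz]

theorem ae_exp_mul_norm_mul_norm_le (f g : fockSpace) :
    ∀ᵐ z : ℂ, Real.exp (-Real.pi * ‖z‖ ^ 2) * (‖(g : Lp ℂ 2 fockMeasure) z‖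
      * ‖(f : Lp ℂ 2 fockMeasure) z‖) ≤ ‖g‖ * ‖f‖ := by
  filter_upwards [ae_fockMeasure_iff.mp (coe_ae_eq_entireRep f),
    ae_fockMeasure_iff.mp (coe_ae_eq_entireRep g)] with z hf hg
  have h1 := exp_mul_sq_norm_le f.1 (differentiable_entireRep f) (coe_ae_eq_entireRep f) z
  have h2 := exp_mul_sq_norm_le g.1 (differentiable_entireRep g) (coe_ae_eq_entireRep g) z
  rw [← hf] at h1
  rw [← hg] at h2
  refine le_of_sq_le_sq ?_ (by positivity)
  have h3 := mul_le_mul h2 h1 (by positivity) (by positivity)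
  rw [Submodule.coe_norm, Submodule.coe_norm]
  calc _ = _ := by ring
    _ ≤ _ := h3
    _ = _ := by ring

section symbol

variable {p : ℝ} {σ : ℂ → ℝ}

/-- Splitting `σ ≤ 1 + σ^p`, the constant part is controlled by `L²` integrability and the part
`σ^p` by the pointwise bound on the product `e^{-π|z|²}‖g‖‖f‖`. -/
theorem norm_mul_inner_bound (hp : 1 < p) (hσ0 : ∀ᵐ z : ℂ, 0 ≤ σ z) (f g : fockSpace) :
    ∀ᵐ z : ℂ, ‖Real.exp (-Real.pi * ‖z‖ ^ 2) • ((σ z : ℂ) *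
        inner ℂ ((g : Lp ℂ 2 fockMeasure) z) ((f : Lp ℂ 2 fockMeasure) z))‖
      ≤ Real.exp (-Real.pi * ‖z‖ ^ 2) • (‖(g : Lp ℂ 2 fockMeasure) z‖
        * ‖(f : Lp ℂ 2 fockMeasure) z‖) + ‖g‖ * ‖f‖ * σ z ^ p := by
  filter_upwards [hσ0, ae_exp_mul_norm_mul_norm_le f g] with z h0 hz
  have h1 := le_add_rpow_mul_rpow hp h0 one_pos
  rw [Real.one_rpow, one_mul] at h1
  rw [norm_smul, norm_mul, Complex.norm_real, RCLike.inner_apply, norm_mul, RCLike.norm_conj,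
    Real.norm_of_nonneg h0, Real.norm_of_nonneg (Real.exp_pos _).le, smul_eq_mul]
  set A := Real.exp (-Real.pi * ‖z‖ ^ 2) * (‖(g : Lp ℂ 2 fockMeasure) z‖
        * ‖(f : Lp ℂ 2 fockMeasure) z‖) with hA
  have hA0 : 0 ≤ A := by positivity
  have hp0 : 0 ≤ σ z ^ p := Real.rpow_nonneg h0 p
  calc _ = A * σ z := by rw [hA]; ring
    _ ≤ A * (1 + σ z ^ p) := by gcongr
    _ = A + A * σ z ^ p := by ring
    _ ≤ A + ‖g‖ * ‖f‖ * σ z ^ p := by gcongr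

theorem integrable_norm_mul_norm (f g : Lp ℂ 2 fockMeasure) :
    Integrable (fun z => ‖g z‖ * ‖f z‖) fockMeasure := by
  refine (L2.integrable_inner (𝕜 := ℂ) g f).norm.congr (ae_of_all _ fun z => ?_)
  simp only [RCLike.inner_apply, norm_mul, RCLike.norm_conj, mul_comm]

theorem integral_norm_mul_norm_le (f g : Lp ℂ 2 fockMeasure) :
    ∫ z, ‖g z‖ * ‖f z‖ ∂fockMeasure ≤ ‖g‖ * ‖f‖ := by
  have h := integral_mul_norm_le_Lp_mul_Lq (μ := fockMeasure) (f := g) (g := f)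
    Real.HolderConjugate.two_two (by simpa using Lp.memLp g) (by simpa using Lp.memLp f)
  simp only [Real.rpow_two, ← sq_norm_eq_integral, ← Real.sqrt_eq_rpow] at h
  rwa [Real.sqrt_sq (norm_nonneg _), Real.sqrt_sq (norm_nonneg _)] at h

theorem integrable_symbol_mul_inner (hp : 1 < p) (hσ : MemLp σ (ENNReal.ofReal p) volume)
    (hσ0 : ∀ᵐ z : ℂ, 0 ≤ σ z) (f g : fockSpace) :
    Integrable (fun z => (σ z : ℂ) * inner ℂ ((g : Lp ℂ 2 fockMeasure) z)
      ((f : Lp ℂ 2 fockMeasure) z)) fockMeasure := by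
  have hmeas : AEStronglyMeasurable (fun z => (σ z : ℂ) * inner ℂ ((g : Lp ℂ 2 fockMeasure) z)
      ((f : Lp ℂ 2 fockMeasure) z)) volume := by
    refine AEStronglyMeasurable.mul
      (Complex.continuous_ofReal.comp_aestronglyMeasurable hσ.1) ?_
    exact (L2.integrable_inner (𝕜 := ℂ) g.1 f.1).1.mono_ac
      volume_absolutelyContinuous_fockMeasure
  rw [integrable_fockMeasure_iff]
  have hexp : AEStronglyMeasurable (fun z : ℂ => Real.exp (-Real.pi * ‖z‖ ^ 2)) volume := by
    fun_prop
  refine Integrable.mono' ?_ (hexp.smul hmeas)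
    (norm_mul_inner_bound hp hσ0 f g)
  exact (integrable_fockMeasure_iff.mp (integrable_norm_mul_norm f.1 g.1)).add
    ((integrable_rpow_of_memLp hp hσ hσ0).const_mul _)

theorem norm_integral_symbol_mul_inner_le (hp : 1 < p)
    (hσ : MemLp σ (ENNReal.ofReal p) volume) (hσ0 : ∀ᵐ z : ℂ, 0 ≤ σ z) (f g : fockSpace) :
    ‖∫ z, (σ z : ℂ) * inner ℂ ((g : Lp ℂ 2 fockMeasure) z)
      ((f : Lp ℂ 2 fockMeasure) z) ∂fockMeasure‖ ≤ (1 + ∫ z : ℂ, σ z ^ p) * ‖g‖ * ‖f‖ := by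
  have h1 := integrable_fockMeasure_iff.mp (integrable_norm_mul_norm f.1 g.1)
  have h2 := (integrable_rpow_of_memLp hp hσ hσ0).const_mul (‖g‖ * ‖f‖)
  rw [integral_fockMeasure]
  refine (norm_integral_le_of_norm_le (h1.add h2) (norm_mul_inner_bound hp hσ0 f g)).trans ?_
  simp only [Pi.add_apply]
  rw [integral_add h1 h2, integral_const_mul, ← integral_fockMeasure]
  have h3 := integral_norm_mul_norm_le f.1 g.1
  rw [Submodule.coe_norm, Submodule.coe_norm]
  nlinarith

theorem exists_isToeplitz (hp : 1 < p) (hσ : MemLp σ (ENNReal.ofReal p) volume)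
    (hσ0 : ∀ᵐ z : ℂ, 0 ≤ σ z) : ∃ T, IsToeplitz σ T := by
  have hint := integrable_symbol_mul_inner hp hσ hσ0
  let L : fockSpace →ₗ⋆[ℂ] fockSpace →ₗ[ℂ] ℂ := LinearMap.mk₂'ₛₗ (starRingEnd ℂ) (RingHom.id ℂ)
    (fun g f : fockSpace => ∫ z, (σ z : ℂ) * inner ℂ ((g : Lp ℂ 2 fockMeasure) z)
      ((f : Lp ℂ 2 fockMeasure) z) ∂fockMeasure)
    (fun g₁ g₂ f => by
      rw [← integral_add (hint f g₁) (hint f g₂)]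
      refine integral_congr_ae ?_
      filter_upwards [Lp.coeFn_add g₁.1 g₂.1] with z hz
      rw [Submodule.coe_add, hz, Pi.add_apply, inner_add_left, mul_add])
    (fun c g f => by
      rw [smul_eq_mul, ← integral_const_mul]
      refine integral_congr_ae ?_
      filter_upwards [Lp.coeFn_smul c g.1] with z hz
      rw [Submodule.coe_smul, hz, Pi.smul_apply, inner_smul_left]
      ring)
    (fun g f₁ f₂ => by
      rw [← integral_add (hint f₁ g) (hint f₂ g)]
      refine integral_congr_ae ?_
      filter_upwards [Lp.coeFn_add f₁.1 f₂.1] with z hz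
      rw [Submodule.coe_add, hz, Pi.add_apply, inner_add_right, mul_add])
    (fun c g f => by
      rw [RingHom.id_apply, smul_eq_mul, ← integral_const_mul]
      refine integral_congr_ae ?_
      filter_upwards [Lp.coeFn_smul c f.1] with z hz
      rw [Submodule.coe_smul, hz, Pi.smul_apply, inner_smul_right]
      ring)
  let B : fockSpace →L⋆[ℂ] fockSpace →L[ℂ] ℂ := L.mkContinuous₂ _
    fun g f => norm_integral_symbol_mul_inner_le hp hσ hσ0 f g
  refine ⟨InnerProductSpace.continuousLinearMapOfBilin B, fun f g => ⟨hint f g, ?_⟩⟩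
  -- Riesz representation puts the operator in the first slot of the inner product. Moving it to the
  -- second costs a conjugation, harmless because `σ` is real.
  refine (inner_conj_symm (𝕜 := ℂ) g _).symm.trans ?_
  rw [InnerProductSpace.continuousLinearMapOfBilin_apply]
  change starRingEnd ℂ (∫ z, (σ z : ℂ) * inner ℂ ((f : Lp ℂ 2 fockMeasure) z)
      ((g : Lp ℂ 2 fockMeasure) z) ∂fockMeasure) = _
  rw [← integral_conj]
  refine integral_congr_ae (ae_of_all _ fun z => ?_)
  simp only [map_mul, Complex.conj_ofReal, inner_conj_symm]

theorem isToeplitz_toeplitz (hp : 1 < p) (hσ : MemLp σ (ENNReal.ofReal p) volume)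
    (hσ0 : ∀ᵐ z : ℂ, 0 ≤ σ z) : IsToeplitz σ (toeplitz σ) := by
  have h := exists_isToeplitz hp hσ hσ0
  rw [toeplitz, dif_pos h]
  exact h.choose_spec

theorem IsRadial.ae_rotate (h : IsRadial σ) (t : ℝ) :
    ∀ᵐ z : ℂ, σ (Complex.exp (t * Complex.I) * z) = σ z := by
  obtain ⟨ρ, hρ⟩ := h
  have hmp : MeasurePreserving (rotation (Circle.exp t)) (volume : Measure ℂ) volume :=
    (rotation (Circle.exp t)).measurePreserving
  filter_upwards [hρ, hmp.quasiMeasurePreserving.ae hρ] with z h1 h2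
  rw [LinearIsometryEquiv.norm_map, rotation_apply, Circle.coe_exp] at h2
  rw [h1, h2]

theorem inner_fockBasis_toeplitz (hσ : AEStronglyMeasurable σ volume) (hrad : IsRadial σ)
    {T : fockSpace →L[ℂ] fockSpace} (hT : IsToeplitz σ T) (f : fockSpace) (k : ℕ) :
    inner ℂ (fockBasis k) (T f) = symbolMoment σ k * inner ℂ (fockBasis k) f := by
  obtain ⟨hint, hval⟩ := hT f (fockBasis k)
  have hcongr := inner_congr_ae (coe_fockBasis k) (coe_ae_eq_entireRep f) σ
  rw [hval, integral_congr_ae hcongr, integral_radial_inner_fockMonomial hσ hrad.ae_rotate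
    (differentiable_entireRep f) k (hint.congr hcongr),
    inner_fockBasis f (differentiable_entireRep f) (coe_ae_eq_entireRep f)]

theorem toeplitz_fockBasis (hσ : AEStronglyMeasurable σ volume) (hrad : IsRadial σ)
    {T : fockSpace →L[ℂ] fockSpace} (hT : IsToeplitz σ T) (k : ℕ) :
    T (fockBasis k) = (symbolMoment σ k : ℂ) • fockBasis k := by
  rw [← sub_eq_zero]
  refine eq_zero_of_inner_fockBasis_eq_zero _ fun j => ?_
  have hsmul := inner_smul_right (𝕜 := ℂ) (fockBasis j) (fockBasis k) (symbolMoment σ k : ℂ)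
  rw [inner_sub_right, inner_fockBasis_toeplitz hσ hrad hT, hsmul,
    orthonormal_iff_ite.mp orthonormal_fockBasis]
  split_ifs with h
  · rw [h, sub_self]
  · simp

theorem integrable_symbol_mul_poissonWeight (hp : 1 < p)
    (hσ : MemLp σ (ENNReal.ofReal p) volume) (hσ0 : ∀ᵐ z : ℂ, 0 ≤ σ z) (k : ℕ) :
    Integrable fun z : ℂ => σ z * poissonWeight k (Real.pi * ‖z‖ ^ 2) := by
  have hc := continuous_poissonWeight k
  refine ((integrable_poissonWeight_comp k).add (integrable_rpow_of_memLp hp hσ hσ0)).mono'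
    (hσ.1.mul (by fun_prop)) ?_
  filter_upwards [hσ0] with z h0
  have h1 := le_add_rpow_mul_rpow hp h0 one_pos
  have hw := poissonWeight_nonneg k (s := Real.pi * ‖z‖ ^ 2) (by positivity)
  have hw1 := poissonWeight_le_one k (s := Real.pi * ‖z‖ ^ 2) (by positivity)
  have hp0 : 0 ≤ σ z ^ p := Real.rpow_nonneg h0 p
  rw [Real.one_rpow, one_mul] at h1
  rw [Real.norm_of_nonneg (mul_nonneg h0 hw), Pi.add_apply]
  nlinarith

theorem symbolMoment_nonneg (hσ0 : ∀ᵐ z : ℂ, 0 ≤ σ z) (k : ℕ) : 0 ≤ symbolMoment σ k := by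
  refine integral_nonneg_of_ae ?_
  filter_upwards [hσ0] with z h0
  exact mul_nonneg h0 (poissonWeight_nonneg k (by positivity))

theorem tendsto_poissonWeight_index (s : ℝ) :
    Tendsto (fun k => poissonWeight k s) atTop (𝓝 0) := by
  have := (FloorSemiring.tendsto_pow_div_factorial_atTop s).mul_const (Real.exp (-s))
  rwa [zero_mul] at this

/-- With `δ = ε/2` in `le_add_rpow_mul_rpow`, the constant part contributes `ε/2` since each weight
has total mass one, and the part with `σ^p` tends to zero by dominated convergence. This plays the
role of compactness in the eigenvalue count. -/
theorem tendsto_symbolMoment (hp : 1 < p) (hσ : MemLp σ (ENNReal.ofReal p) volume)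
    (hσ0 : ∀ᵐ z : ℂ, 0 ≤ σ z) : Tendsto (symbolMoment σ) atTop (𝓝 0) := by
  have hσp := integrable_rpow_of_memLp hp hσ hσ0
  have hbound : ∀ k, ∀ᵐ z : ℂ,
      ‖σ z ^ p * poissonWeight k (Real.pi * ‖z‖ ^ 2)‖ ≤ σ z ^ p := by
    intro k
    filter_upwards [hσ0] with z h0
    have hw := poissonWeight_nonneg k (s := Real.pi * ‖z‖ ^ 2) (by positivity)
    have hw1 := poissonWeight_le_one k (s := Real.pi * ‖z‖ ^ 2) (by positivity)
    have hp0 : 0 ≤ σ z ^ p := Real.rpow_nonneg h0 p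
    rw [Real.norm_of_nonneg (mul_nonneg hp0 hw)]
    exact mul_le_of_le_one_right hp0 hw1
  have hmeas : ∀ k, AEStronglyMeasurable
      (fun z : ℂ => σ z ^ p * poissonWeight k (Real.pi * ‖z‖ ^ 2)) volume := fun k => by
    have hc := continuous_poissonWeight k
    exact hσp.1.mul (by fun_prop)
  have htail : Tendsto (fun k => ∫ z : ℂ, σ z ^ p * poissonWeight k (Real.pi * ‖z‖ ^ 2))
      atTop (𝓝 0) := by
    have := tendsto_integral_of_dominated_convergence (fun z => σ z ^ p) hmeas hσp hbound
      (f := fun _ => 0) (ae_of_all _ fun z => by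
        simpa using (tendsto_poissonWeight_index (Real.pi * ‖z‖ ^ 2)).const_mul (σ z ^ p))
    simpa using this
  rw [Metric.tendsto_atTop]
  intro ε hε
  have h2 := (htail.const_mul ((ε / 2) ^ (1 - p)))
  rw [mul_zero] at h2
  obtain ⟨N, hN⟩ := eventually_atTop.mp (h2.eventually (gt_mem_nhds (half_pos hε)))
  refine ⟨N, fun k hk => ?_⟩
  rw [Real.dist_eq, sub_zero, abs_of_nonneg (symbolMoment_nonneg hσ0 k)]
  have hi1 := (integrable_poissonWeight_comp k).const_mul (ε / 2)
  have hi2 := (hσp.mono' (hmeas k) (hbound k)).const_mul ((ε / 2) ^ (1 - p))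
  have hle : symbolMoment σ k ≤ ∫ z : ℂ, (ε / 2 * poissonWeight k (Real.pi * ‖z‖ ^ 2)
      + (ε / 2) ^ (1 - p) * (σ z ^ p * poissonWeight k (Real.pi * ‖z‖ ^ 2))) := by
    refine integral_mono_ae (integrable_symbol_mul_poissonWeight hp hσ hσ0 k) (hi1.add hi2) ?_
    filter_upwards [hσ0] with z h0
    have hw := poissonWeight_nonneg k (s := Real.pi * ‖z‖ ^ 2) (by positivity)
    have h1 := mul_le_mul_of_nonneg_right (le_add_rpow_mul_rpow hp h0 (half_pos hε)) hw
    linarith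
  rw [integral_add hi1 hi2, integral_const_mul, integral_const_mul,
    integral_poissonWeight_comp] at hle
  have := hN k hk
  linarith

end symbol

/-! ### Eigenvalues of diagonal operators -/

theorem finite_setOf_le_of_tendsto_zero {m : ℕ → ℝ} (hm : Tendsto m atTop (𝓝 0)) {t : ℝ}
    (ht : 0 < t) : {k | t ≤ m k}.Finite := by
  obtain ⟨N, hN⟩ := eventually_atTop.mp (hm.eventually (gt_mem_nhds ht))
  refine (finite_lt_nat N).subset fun k (hk : t ≤ m k) => ?_
  by_contra h
  exact absurd (hN k (not_lt.mp h)) (not_lt.mpr hk)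

section diagonal

variable {H : Type*} [NormedAddCommGroup H] [InnerProductSpace ℂ H] {e : ℕ → H} {m : ℕ → ℝ}
  {T : H →L[ℂ] H}

/-- An eigenvector for `μ ≥ t` is orthogonal to every `e j` with `m j < t`, so by totality it equals
its finite expansion over `S`. -/
theorem iSup_eigenspace_eq_span (he : Orthonormal ℂ e)
    (htot : ∀ v, (∀ k, inner ℂ (e k) v = 0) → v = 0)
    (hTe : ∀ k, T (e k) = (m k : ℂ) • e k)
    (hT : ∀ k v, inner ℂ (e k) (T v) = m k * inner ℂ (e k) v) {t : ℝ} {S : Finset ℕ}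
    (hS : ∀ k, k ∈ S ↔ t ≤ m k) :
    (⨆ (μ : ℝ) (_ : t ≤ μ), Module.End.eigenspace (T : H →ₗ[ℂ] H) (μ : ℂ) : Submodule ℂ H)
      = Submodule.span ℂ (range fun k : S => e k) := by
  refine le_antisymm (iSup₂_le fun μ hμ v hv => ?_) (Submodule.span_le.mpr ?_)
  · rw [Module.End.mem_eigenspace_iff] at hv
    have hv' : T v = (μ : ℂ) • v := hv
    have hzero : ∀ j, j ∉ S → inner ℂ (e j) v = 0 := by
      intro j hj
      rw [hS, not_le] at hj
      have h1 := hT j v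
      rw [hv', inner_smul_right] at h1
      have h2 : ((μ - m j : ℝ) : ℂ) * inner ℂ (e j) v = 0 := by
        push_cast
        rw [sub_mul, h1, sub_self]
      have hne : μ - m j ≠ 0 := (show 0 < μ - m j by linarith).ne'
      have h3 : ((μ - m j : ℝ) : ℂ) ≠ 0 := by exact_mod_cast hne
      exact (mul_eq_zero.mp h2).resolve_left h3
    have hv2 : v = ∑ k ∈ S, inner ℂ (e k) v • e k := by
      rw [← sub_eq_zero]
      refine htot _ fun j => ?_
      simp only [inner_sub_right, inner_sum, inner_smul_right, orthonormal_iff_ite.mp he,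
        mul_ite, mul_one, mul_zero, Finset.sum_ite_eq]
      split_ifs with hj
      · exact sub_self _
      · rw [hzero j hj, sub_zero]
    rw [hv2]
    exact Submodule.sum_mem _ fun k hk =>
      Submodule.smul_mem _ _ (Submodule.subset_span ⟨⟨k, hk⟩, rfl⟩)
  · rintro _ ⟨k, rfl⟩
    refine Submodule.mem_iSup_of_mem (m k) (Submodule.mem_iSup_of_mem ((hS k).mp k.2) ?_)
    rw [Module.End.mem_eigenspace_iff]
    exact hTe k

theorem natCast_le_rank_iff (he : Orthonormal ℂ e)
    (htot : ∀ v, (∀ k, inner ℂ (e k) v = 0) → v = 0)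
    (hTe : ∀ k, T (e k) = (m k : ℂ) • e k)
    (hT : ∀ k v, inner ℂ (e k) (T v) = m k * inner ℂ (e k) v) {t : ℝ} {S : Finset ℕ}
    (hS : ∀ k, k ∈ S ↔ t ≤ m k) (n : ℕ) :
    (n : Cardinal) ≤ Module.rank ℂ
      (⨆ (μ : ℝ) (_ : t ≤ μ), Module.End.eigenspace (T : H →ₗ[ℂ] H) (μ : ℂ) : Submodule ℂ H)
      ↔ n ≤ S.card := by
  have hli : LinearIndependent ℂ fun k : S => e k :=
    he.linearIndependent.comp _ Subtype.val_injective
  have hfin : Module.Finite ℂ (Submodule.span ℂ (range fun k : S => e k)) :=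
    FiniteDimensional.span_of_finite ℂ (finite_range _)
  rw [iSup_eigenspace_eq_span he htot hTe hT hS, ← Module.finrank_eq_rank,
    finrank_span_eq_card hli, Fintype.card_coe, Nat.cast_le]

/-- If some value outside `K` is positive, only finitely many values reach it; otherwise all values
outside `K` vanish and any such index works. -/
theorem exists_maximal_notMem (hm0 : ∀ k, 0 ≤ m k) (hm : Tendsto m atTop (𝓝 0))
    (K : Finset ℕ) : ∃ k, k ∉ K ∧ ∀ j, j ∉ K → m j ≤ m k := by
  by_cases h : ∃ k, k ∉ K ∧ 0 < m k
  · obtain ⟨k₁, hk₁, hpos⟩ := h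
    have hfin := finite_setOf_le_of_tendsto_zero hm hpos
    obtain ⟨k, hk, hmax⟩ := (hfin.toFinset \ K).exists_max_image m
      ⟨k₁, by simp [hk₁]⟩
    simp only [Finset.mem_sdiff, Finite.mem_toFinset, Set.mem_ofPred_eq] at hk hmax
    refine ⟨k, hk.2, fun j hj => ?_⟩
    rcases le_total (m k₁) (m j) with h | h
    · exact hmax j ⟨h, hj⟩
    · exact h.trans hk.1
  · push Not at h
    obtain ⟨k, hk⟩ := Infinite.exists_notMem_finset K
    exact ⟨k, hk, fun j hj => (h j hj).trans (hm0 k)⟩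

/-- Greedy choice: `K` holds `n` indices of largest values, and the next eigenvalue is the largest
value left outside `K`. -/
theorem exists_sum_nthEigenvalue_eq (he : Orthonormal ℂ e)
    (htot : ∀ v, (∀ k, inner ℂ (e k) v = 0) → v = 0)
    (hTe : ∀ k, T (e k) = (m k : ℂ) • e k)
    (hT : ∀ k v, inner ℂ (e k) (T v) = m k * inner ℂ (e k) v)
    (hm0 : ∀ k, 0 ≤ m k) (hm : Tendsto m atTop (𝓝 0)) (n : ℕ) :
    ∃ K : Finset ℕ, K.card = n ∧ ∑ i ∈ Finset.Icc 1 n, nthEigenvalue T i = ∑ k ∈ K, m k ∧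
      ∀ j ∈ K, ∀ k, k ∉ K → m k ≤ m j := by
  induction n with
  | zero => exact ⟨∅, by simp⟩
  | succ n ih =>
    obtain ⟨K, hcard, hsum, hK⟩ := ih
    obtain ⟨k₀, hk₀, hmax⟩ := exists_maximal_notMem hm0 hm K
    have hset : {t : ℝ | 0 < t ∧ ((n + 1 : ℕ) : Cardinal) ≤ Module.rank ℂ
        (⨆ (μ : ℝ) (_ : t ≤ μ), Module.End.eigenspace (T : H →ₗ[ℂ] H) (μ : ℂ) : Submodule ℂ H)}
        = Ioc 0 (m k₀) := by
      ext t
      simp only [Set.mem_ofPred_eq, mem_Ioc]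
      refine and_congr_right fun ht => ?_
      have hfin := finite_setOf_le_of_tendsto_zero hm ht
      rw [natCast_le_rank_iff he htot hTe hT (S := hfin.toFinset) (by simp)]
      constructor
      · intro hc
        obtain ⟨k, hk, hkK⟩ := Finset.exists_mem_notMem_of_card_lt_card
          (show K.card < hfin.toFinset.card by omega)
        rw [Finite.mem_toFinset] at hk
        exact le_trans hk (hmax k hkK)
      · intro hle
        rw [← hcard, ← Finset.card_insert_of_notMem hk₀]
        refine Finset.card_le_card fun k hk => ?_
        rw [Finite.mem_toFinset]
        rcases Finset.mem_insert.mp hk with rfl | hk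
        · exact hle
        · exact hle.trans (hK k hk k₀ hk₀)
    have hval : nthEigenvalue T (n + 1) = m k₀ := by
      rw [nthEigenvalue, hset]
      rcases (hm0 k₀).eq_or_lt with h | h
      -- If the largest remaining value is `0`, no positive `t` is admissible and the supremum of
      -- the empty set, `0` by convention, is still the right value.
      · rw [← h, Ioc_self, Real.sSup_empty]
      · exact csSup_Ioc h
    refine ⟨insert k₀ K, by rw [Finset.card_insert_of_notMem hk₀, hcard], ?_, ?_⟩
    · rw [Finset.sum_Icc_succ_top (by omega), hsum, hval, Finset.sum_insert hk₀, add_comm]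
    · intro j hj k hk
      rw [Finset.mem_insert, not_or] at hk
      rcases Finset.mem_insert.mp hj with rfl | hj
      · exact hmax k hk.2
      · exact hK j hj k hk.2

theorem sum_le_sum_of_card_eq {K L : Finset ℕ} (hcard : L.card = K.card)
    (hK : ∀ j ∈ K, ∀ k, k ∉ K → m k ≤ m j) : ∑ k ∈ L, m k ≤ ∑ k ∈ K, m k := by
  rw [← Finset.sum_inter_add_sum_sdiff L K, ← Finset.sum_inter_add_sum_sdiff K L,
    Finset.inter_comm K L]
  refine add_le_add_right ?_ _
  have hc : (L \ K).card = (K \ L).card := Finset.card_sdiff_comm hcard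
  rcases (K \ L).eq_empty_or_nonempty with h | h
  · rw [h, Finset.card_empty, Finset.card_eq_zero] at hc
    rw [h, hc]
  · obtain ⟨j, hj, hmin⟩ := (K \ L).exists_min_image m h
    calc ∑ k ∈ L \ K, m k ≤ (L \ K).card • m j :=
          Finset.sum_le_card_nsmul _ _ _ fun k hk =>
            hK j (Finset.mem_sdiff.mp hj).1 k (Finset.mem_sdiff.mp hk).2
      _ = (K \ L).card • m j := by rw [hc]
      _ ≤ ∑ k ∈ K \ L, m k := Finset.card_nsmul_le_sum _ _ _ hmin

end diagonal

/-! ### Sums of eigenvalues and the optimal symbol -/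

variable {p B : ℝ} {n : ℕ} {σ : ℂ → ℝ}

theorem exists_sum_toeplitzEigenvalue_eq (hp : 1 < p) (hσ : MemLp σ (ENNReal.ofReal p) volume)
    (hσ0 : ∀ᵐ z : ℂ, 0 ≤ σ z) (hrad : IsRadial σ) (n : ℕ) :
    ∃ K : Finset ℕ, K.card = n ∧
      ∑ i ∈ Finset.Icc 1 n, toeplitzEigenvalue σ i = ∑ k ∈ K, symbolMoment σ k ∧
      ∀ L : Finset ℕ, L.card = n →
        ∑ k ∈ L, symbolMoment σ k ≤ ∑ i ∈ Finset.Icc 1 n, toeplitzEigenvalue σ i := by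
  have hT := isToeplitz_toeplitz hp hσ hσ0
  obtain ⟨K, hcard, hsum, hK⟩ := exists_sum_nthEigenvalue_eq orthonormal_fockBasis
    eq_zero_of_inner_fockBasis_eq_zero (toeplitz_fockBasis hσ.1 hrad hT)
    (fun k v => inner_fockBasis_toeplitz hσ.1 hrad hT v k) (symbolMoment_nonneg hσ0)
    (tendsto_symbolMoment hp hσ hσ0) n
  refine ⟨K, hcard, hsum, fun L hL => ?_⟩
  exact (sum_le_sum_of_card_eq (hL.trans hcard.symm) hK).trans_eq hsum.symm

theorem sum_symbolMoment (hp : 1 < p) (hσ : MemLp σ (ENNReal.ofReal p) volume)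
    (hσ0 : ∀ᵐ z : ℂ, 0 ≤ σ z) (K : Finset ℕ) :
    ∑ k ∈ K, symbolMoment σ k = ∫ z : ℂ, σ z * poissonSum K (Real.pi * ‖z‖ ^ 2) := by
  simp only [symbolMoment, poissonSum, Finset.mul_sum]
  rw [integral_finsetSum _ fun k _ => integrable_symbol_mul_poissonWeight hp hσ hσ0 k]

theorem integrable_symbol_mul_poissonSum (hp : 1 < p) (hσ : MemLp σ (ENNReal.ofReal p) volume)
    (hσ0 : ∀ᵐ z : ℂ, 0 ≤ σ z) (K : Finset ℕ) :
    Integrable fun z : ℂ => σ z * poissonSum K (Real.pi * ‖z‖ ^ 2) := by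
  simp only [poissonSum, Finset.mul_sum]
  exact integrable_finsetSum _ fun k _ => integrable_symbol_mul_poissonWeight hp hσ hσ0 k

theorem integral_rpow_le_of_eLpNorm_le (hp : 1 < p) (hB : 0 < B)
    (hσ : MemLp σ (ENNReal.ofReal p) volume) (hσ0 : ∀ᵐ z : ℂ, 0 ≤ σ z)
    (hle : eLpNorm σ (ENNReal.ofReal p) volume ≤ ENNReal.ofReal B) :
    ∫ z : ℂ, σ z ^ p ≤ B ^ p := by
  have hp0 : 0 < p := by linarith
  have hcongr : ∫ z : ℂ, ‖σ z‖ ^ p = ∫ z : ℂ, σ z ^ p :=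
    integral_congr_ae (hσ0.mono fun z hz => by simp only [Real.norm_of_nonneg hz])
  have hnn : 0 ≤ ∫ z : ℂ, σ z ^ p :=
    integral_nonneg_of_ae (hσ0.mono fun z hz => Real.rpow_nonneg hz p)
  rw [hσ.eLpNorm_eq_integral_rpow_norm (by simpa using hp0) ENNReal.ofReal_ne_top,
    ENNReal.toReal_ofReal hp0.le, hcongr, ENNReal.ofReal_le_ofReal_iff hB.le] at hle
  exact (Real.rpow_inv_le_iff_of_pos hnn hB.le hp0).mp hle

/-! ### The normalizing constant and the optimal symbol -/

theorem integral_deriv_G_rpow_pos (hp : 1 < p) (hn : 1 ≤ n) :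
    0 < ∫ s in Ioi (0 : ℝ), poissonSum (Finset.range n) s ^ (p / (p - 1)) := by
  have hq : 1 < p / (p - 1) := by rw [lt_div_iff₀] <;> linarith
  have hnn : ∀ᵐ s ∂(volume.restrict (Ioi (0 : ℝ))),
      0 ≤ poissonSum (Finset.range n) s ^ (p / (p - 1)) := by
    filter_upwards [ae_restrict_mem measurableSet_Ioi] with s hs
      using Real.rpow_nonneg (poissonSum_nonneg _ (le_of_lt hs)) _
  refine lt_of_le_of_ne (integral_nonneg_of_ae hnn) fun h => ?_
  have h0 := (integral_eq_zero_iff_of_nonneg_ae hnn (integrableOn_poissonSum_rpow _ hq)).mp h.symm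
  have hempty : Finset.range n = ∅ := by
    apply poissonSum_ae_injective
    filter_upwards [h0, ae_restrict_mem measurableSet_Ioi] with s hs hs0
    rw [(Real.rpow_eq_zero (poissonSum_nonneg _ (le_of_lt hs0)) (by linarith)).mp hs]
    simp [poissonSum]
  rw [Finset.range_eq_empty_iff] at hempty
  omega

theorem cConst_eq (p : ℝ) (n : ℕ) :
    cConst p n
      = (∫ s in Ioi (0 : ℝ), poissonSum (Finset.range n) s ^ (p / (p - 1))) ^ (1 / p) := by
  rw [cConst, deriv_G]

theorem cConst_pos (hp : 1 < p) (hn : 1 ≤ n) : 0 < cConst p n := by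
  rw [cConst_eq]
  exact Real.rpow_pos_of_pos (integral_deriv_G_rpow_pos hp hn) _

theorem cConst_rpow (hp : 1 < p) (hn : 1 ≤ n) :
    cConst p n ^ p = ∫ s in Ioi (0 : ℝ), poissonSum (Finset.range n) s ^ (p / (p - 1)) := by
  rw [cConst_eq, ← Real.rpow_mul (integral_deriv_G_rpow_pos hp hn).le,
    one_div_mul_cancel (by linarith), Real.rpow_one]

theorem optSymbol_eq (p B : ℝ) (n : ℕ) (z : ℂ) :
    optSymbol p B n z = B / cConst p n
      * poissonSum (Finset.range n) (Real.pi * ‖z‖ ^ 2) ^ (1 / (p - 1)) := by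
  rw [optSymbol, poissonSum_eq, Real.mul_rpow (Finset.sum_nonneg fun k _ => by positivity)
    (Real.exp_pos _).le, ← Real.exp_mul, mul_one_div, mul_assoc]

theorem optSymbol_nonneg (hp : 1 < p) (hB : 0 < B) (hn : 1 ≤ n) (z : ℂ) :
    0 ≤ optSymbol p B n z := by
  rw [optSymbol_eq]
  have := cConst_pos hp hn
  have := poissonSum_nonneg (Finset.range n) (s := Real.pi * ‖z‖ ^ 2) (by positivity)
  positivity

theorem continuous_optSymbol (hp : 1 < p) : Continuous (optSymbol p B n) := by
  have h : optSymbol p B n = fun z : ℂ => B / cConst p n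
      * poissonSum (Finset.range n) (Real.pi * ‖z‖ ^ 2) ^ (1 / (p - 1)) :=
    funext (optSymbol_eq p B n)
  have hr : 0 ≤ 1 / (p - 1) := one_div_nonneg.mpr (by linarith)
  have hc := continuous_poissonSum_rpow (Finset.range n) hr
  rw [h]
  exact continuous_const.mul (hc.comp (f := fun z : ℂ => Real.pi * ‖z‖ ^ 2) (by fun_prop))

theorem isRadial_optSymbol : IsRadial (optSymbol p B n) :=
  ⟨fun r => B / cConst p n * poissonSum (Finset.range n) (Real.pi * r ^ 2) ^ (1 / (p - 1)),
    ae_of_all _ fun z => optSymbol_eq p B n z⟩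

theorem integrable_poissonSum_rpow_comp (K : Finset ℕ) {q : ℝ} (hq : 1 < q) :
    Integrable fun z : ℂ => poissonSum K (Real.pi * ‖z‖ ^ 2) ^ q :=
  integrable_comp_pi_mul_norm_sq (continuous_poissonSum_rpow K (by linarith))
    (integrableOn_poissonSum_rpow K hq)

theorem integral_poissonSum_rpow_comp (K : Finset ℕ) {q : ℝ} (hq : 1 < q) :
    ∫ z : ℂ, poissonSum K (Real.pi * ‖z‖ ^ 2) ^ q = ∫ s in Ioi (0 : ℝ), poissonSum K s ^ q :=
  integral_comp_pi_mul_norm_sq (continuous_poissonSum_rpow K (by linarith))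

theorem optSymbol_rpow (hp : 1 < p) (hB : 0 < B) (hn : 1 ≤ n) (z : ℂ) :
    optSymbol p B n z ^ p = (B / cConst p n) ^ p
      * poissonSum (Finset.range n) (Real.pi * ‖z‖ ^ 2) ^ (p / (p - 1)) := by
  have := cConst_pos hp hn
  have := poissonSum_nonneg (Finset.range n) (s := Real.pi * ‖z‖ ^ 2) (by positivity)
  rw [optSymbol_eq, Real.mul_rpow (by positivity) (by positivity), ← Real.rpow_mul this,
    one_div_mul_eq_div]

theorem memLp_optSymbol (hp : 1 < p) (hB : 0 < B) (hn : 1 ≤ n) :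
    MemLp (optSymbol p B n) (ENNReal.ofReal p) volume := by
  have hq : 1 < p / (p - 1) := by rw [lt_div_iff₀] <;> linarith
  rw [← integrable_norm_rpow_iff (continuous_optSymbol hp).aestronglyMeasurable
    (by simpa using by linarith) ENNReal.ofReal_ne_top, ENNReal.toReal_ofReal (by linarith)]
  simp only [Real.norm_of_nonneg (optSymbol_nonneg hp hB hn _), optSymbol_rpow hp hB hn]
  exact (integrable_poissonSum_rpow_comp _ hq).const_mul _

theorem div_cConst_rpow_mul (hp : 1 < p) (hB : 0 < B) (hn : 1 ≤ n) :
    (B / cConst p n) ^ p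
      * ∫ s in Ioi (0 : ℝ), poissonSum (Finset.range n) s ^ (p / (p - 1)) = B ^ p := by
  have hc := cConst_pos hp hn
  rw [← cConst_rpow hp hn, ← Real.mul_rpow (by positivity) hc.le, div_mul_cancel₀ _ hc.ne']

theorem eLpNorm_optSymbol (hp : 1 < p) (hB : 0 < B) (hn : 1 ≤ n) :
    eLpNorm (optSymbol p B n) (ENNReal.ofReal p) volume = ENNReal.ofReal B := by
  have hp0 : 0 < p := by linarith
  have hq : 1 < p / (p - 1) := by rw [lt_div_iff₀] <;> linarith
  rw [(memLp_optSymbol hp hB hn).eLpNorm_eq_integral_rpow_norm (by simpa using hp0)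
    ENNReal.ofReal_ne_top, ENNReal.toReal_ofReal hp0.le]
  simp only [Real.norm_of_nonneg (optSymbol_nonneg hp hB hn _), optSymbol_rpow hp hB hn]
  rw [integral_const_mul, integral_poissonSum_rpow_comp _ hq, div_cConst_rpow_mul hp hB hn,
    Real.rpow_rpow_inv hB.le hp0.ne']

theorem sum_symbolMoment_optSymbol (hp : 1 < p) (hB : 0 < B) (hn : 1 ≤ n) :
    ∑ k ∈ Finset.range n, symbolMoment (optSymbol p B n) k = B / cConst p n
      * ∫ s in Ioi (0 : ℝ), poissonSum (Finset.range n) s ^ (p / (p - 1)) := by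
  have hp1 : p - 1 ≠ 0 := by linarith
  have hq : 1 < p / (p - 1) := by rw [lt_div_iff₀] <;> linarith
  have hexp : 1 / (p - 1) = p / (p - 1) - 1 := by field_simp; ring
  rw [sum_symbolMoment hp (memLp_optSymbol hp hB hn) (ae_of_all _ (optSymbol_nonneg hp hB hn)),
    ← integral_poissonSum_rpow_comp _ hq, ← integral_const_mul]
  refine integral_congr_ae (ae_of_all _ fun z => ?_)
  simp only
  rw [optSymbol_eq, mul_assoc, hexp, poissonSum_rpow_sub_one_mul _ hq (by positivity)]

/-- Young is applied to `σ / A` and `W_K` with `A = B / c_p`. This scaling gives `∫ (σ/A)^p ≤ I`,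
where `I = c_p^p`, while `∫ W_K^q ≤ I` by extremality of `range n`; the two terms add up to `I/p +
I/q = I`. -/
theorem sum_symbolMoment_le (hp : 1 < p) (hB : 0 < B) (hn : 1 ≤ n)
    (hσ : MemLp σ (ENNReal.ofReal p) volume) (hσ0 : ∀ᵐ z : ℂ, 0 ≤ σ z)
    (hle : eLpNorm σ (ENNReal.ofReal p) volume ≤ ENNReal.ofReal B) {K : Finset ℕ}
    (hK : K.card = n) :
    ∑ k ∈ K, symbolMoment σ k ≤ B / cConst p n
        * ∫ s in Ioi (0 : ℝ), poissonSum (Finset.range n) s ^ (p / (p - 1)) ∧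
    (∑ k ∈ K, symbolMoment σ k = B / cConst p n
        * ∫ s in Ioi (0 : ℝ), poissonSum (Finset.range n) s ^ (p / (p - 1)) →
      ∀ᵐ z : ℂ, σ z = optSymbol p B n z) := by
  have hp0 : 0 < p := by linarith
  have hp1 : 0 < p - 1 := by linarith
  have hq : 1 < p / (p - 1) := by rw [lt_div_iff₀] <;> linarith
  have hpq : p.HolderConjugate (p / (p - 1)) := Real.HolderConjugate.conjExponent hp
  have hc := cConst_pos hp hn
  have hI := div_cConst_rpow_mul hp hB hn
  have hKle := integral_poissonSum_rpow_le hq K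
  have hKlt := integral_poissonSum_rpow_lt hq K
  have hσp := integrable_rpow_of_memLp hp hσ hσ0
  have hσB := integral_rpow_le_of_eLpNorm_le hp hB hσ hσ0 hle
  have hopt := optSymbol_rpow hp hB hn
  have hopt0 := optSymbol_nonneg hp hB hn
  rw [hK] at hKle hKlt
  set A := B / cConst p n with hA
  have hA0 : 0 < A := by positivity
  set q := p / (p - 1) with hqdef
  set I := ∫ s in Ioi (0 : ℝ), poissonSum (Finset.range n) s ^ q
  have hAp : 0 < A ^ p := by positivity
  have hdiv : ∀ z, 0 ≤ σ z → (σ z / A) ^ p = (A ^ p)⁻¹ * σ z ^ p := fun z hz => by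
    rw [Real.div_rpow hz hA0.le, div_eq_inv_mul]
  have hdivae : (fun z => (A ^ p)⁻¹ * σ z ^ p) =ᵐ[volume] fun z => (σ z / A) ^ p :=
    hσ0.mono fun z hz => (hdiv z hz).symm
  have hmul : ∀ z : ℂ, A⁻¹ * (σ z * poissonSum K (Real.pi * ‖z‖ ^ 2))
      = σ z / A * poissonSum K (Real.pi * ‖z‖ ^ 2) := fun z => by ring
  have hprod := (integrable_symbol_mul_poissonSum hp hσ hσ0 K).const_mul A⁻¹
  simp only [hmul] at hprod
  obtain ⟨hY, hYeq⟩ := integral_mul_le_young (μ := (volume : Measure ℂ)) hpq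
    (f := fun z => σ z / A) (g := fun z => poissonSum K (Real.pi * ‖z‖ ^ 2))
    (hσ0.mono fun z hz => div_nonneg hz hA0.le)
    (ae_of_all _ fun z => poissonSum_nonneg K (by positivity))
    ((hσp.const_mul _).congr hdivae) (integrable_poissonSum_rpow_comp K hq) hprod
  simp only [← hmul] at hY hYeq
  rw [integral_const_mul, ← integral_congr_ae hdivae, integral_const_mul,
    integral_poissonSum_rpow_comp K hq, ← sum_symbolMoment hp hσ hσ0] at hY hYeq
  set S := ∑ k ∈ K, symbolMoment σ k
  set J := ∫ s in Ioi (0 : ℝ), poissonSum K s ^ q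
  set N := ∫ z : ℂ, σ z ^ p
  have hN : (A ^ p)⁻¹ * N ≤ I := by
    rw [inv_mul_le_iff₀ hAp, hI]
    exact hσB
  have hNp : (A ^ p)⁻¹ * N / p ≤ I / p := by gcongr
  have hq0 : 0 < q := by linarith
  have hJq : J / q ≤ I / q := by gcongr
  have hIsum : I / p + I / q = I := by
    rw [div_eq_mul_inv, div_eq_mul_inv, ← mul_add, hpq.inv_add_inv_eq_one, mul_one]
  constructor
  · rw [← inv_mul_le_iff₀ hA0]
    linarith
  · intro hS
    have hS' : A⁻¹ * S = I := by rw [hS, ← mul_assoc, inv_mul_cancel₀ hA0.ne', one_mul]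
    -- Equality leaves no slack in either term: first `K = range n`, then the equality case of Young
    -- gives `σ = σ_p`.
    have hJI : J / q = I / q := by linarith
    have hKn : K = Finset.range n := by
      by_contra h
      have := div_lt_div_of_pos_right (hKlt h) hq0
      exact absurd hJI this.ne
    filter_upwards [hYeq (by linarith), hσ0] with z hz hz0
    rw [hdiv z hz0, hKn, inv_mul_eq_iff_eq_mul₀ hAp.ne', ← hopt] at hz
    exact (Real.rpow_left_inj hz0 (hopt0 z) hp0.ne').mp hz

end FockToeplitz

end

/-! ### The extremal theorem -/

open MeasureTheory FockToeplitz in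
theorem theorem5p2 (p B : ℝ) (hp : 1 < p) (hB : 0 < B) (n : ℕ) (hn : 1 ≤ n) :
    -- the constant is well defined and positive, and the optimal symbol is admissible
    IntegrableOn (fun s => (deriv (G n) s) ^ (p / (p - 1))) (Set.Ioi (0 : ℝ)) ∧
    0 < cConst p n ∧
    MemLp (optSymbol p B n) (ENNReal.ofReal p) volume ∧
    eLpNorm (optSymbol p B n) (ENNReal.ofReal p) volume ≤ ENNReal.ofReal B ∧
    IsToeplitz (optSymbol p B n) (toeplitz (optSymbol p B n)) ∧
    ∀ σ : ℂ → ℝ, MemLp σ (ENNReal.ofReal p) volume → (∀ᵐ z : ℂ, 0 ≤ σ z) → IsRadial σ →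
      eLpNorm σ (ENNReal.ofReal p) volume ≤ ENNReal.ofReal B →
      IsToeplitz σ (toeplitz σ) ∧
      ∑ k ∈ Finset.Icc 1 n, toeplitzEigenvalue σ k ≤
        ∑ k ∈ Finset.Icc 1 n, toeplitzEigenvalue (optSymbol p B n) k ∧
      (∑ k ∈ Finset.Icc 1 n, toeplitzEigenvalue σ k =
          ∑ k ∈ Finset.Icc 1 n, toeplitzEigenvalue (optSymbol p B n) k ↔
        ∀ᵐ z : ℂ, σ z = optSymbol p B n z) := by
  have hq : 1 < p / (p - 1) := by rw [lt_div_iff₀] <;> linarith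
  have hopt := memLp_optSymbol hp hB hn
  have hoptNorm := (eLpNorm_optSymbol hp hB hn).le
  have hopt0 : ∀ᵐ z : ℂ, 0 ≤ optSymbol p B n z := ae_of_all _ (optSymbol_nonneg hp hB hn)
  refine ⟨?_, cConst_pos hp hn, hopt, hoptNorm, isToeplitz_toeplitz hp hopt hopt0, ?_⟩
  · rw [deriv_G]
    exact integrableOn_poissonSum_rpow _ hq
  intro σ hσ hσ0 hrad hle
  obtain ⟨K₀, hK₀, hsum₀, hmax₀⟩ :=
    exists_sum_toeplitzEigenvalue_eq hp hopt hopt0 isRadial_optSymbol n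
  obtain ⟨K, hK, hsum, hmax⟩ := exists_sum_toeplitzEigenvalue_eq hp hσ hσ0 hrad n
  have hval := sum_symbolMoment_optSymbol hp hB hn
  -- The general bound holds for the maximizing set of `σ_p`, and `range n` already attains it.
  have hoptSum : ∑ k ∈ Finset.Icc 1 n, toeplitzEigenvalue (optSymbol p B n) k = _ :=
    le_antisymm (hsum₀.trans_le (sum_symbolMoment_le hp hB hn hopt hopt0 hoptNorm hK₀).1)
      (hval.symm.trans_le (hmax₀ _ (Finset.card_range n)))
  obtain ⟨hS, hSeq⟩ := sum_symbolMoment_le hp hB hn hσ hσ0 hle hK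
  refine ⟨isToeplitz_toeplitz hp hσ hσ0, ?_, ?_, ?_⟩
  · rw [hsum, hoptSum]
    exact hS
  · intro h
    exact hSeq (by rw [← hsum, h, hoptSum])
  · intro h
    -- Only moments need comparing: those of `σ` over `range n` already sum to the optimal value,
    -- and they bound its eigenvalue sum from below.
    have hmom : ∀ k, symbolMoment σ k = symbolMoment (optSymbol p B n) k := fun k =>
      integral_congr_ae (h.mono fun z hz => by simp only [hz])
    refine le_antisymm (by rw [hsum, hoptSum]; exact hS) ?_
    rw [hoptSum, ← hval]
    simp only [← hmom]
    exact hmax _ (Finset.card_range n)
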